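/- A labelled Dyck path $P$ of order $n$ consists of a Dyck path from $(0,0)$ to $(n,n)$, encoded by its area sequence $a_1,\dots,a_n\ge 0$ (with $a_1=0$ and $a_{i+1}\le a_i+1$), and positive integer labels $\ell_1,\dots,\ell_n$ of its rows that strictly increase up columns, that is, $\ell_i<\ell_{i+1}$ whenever $a_{i+1}=a_i+1$. Put $\mathrm{area}(P)=\sum_i a_i$, $x^P=\prod_i x_{\ell_i}$, $$d_i(P)=\#\{j>i : a_i=a_j,\ \ell_i<\ell_j\}+\#\{j>i : a_i=a_j+1,\ \ell_i>\ell_j\},\qquad \mathrm{dinv}(P)=\sum_i d_i(P),$$ $$\mathrm{Val}(P)=\{\,2\le i\le n : a_i<a_{i-1}\,\}\cup\{\,2\le i\le n : a_i=a_{i-1},\ \ell_i>\ell_{i-1}\,\}.$$ For integers $n>k\ge 0$ let $\mathrm{Val}_{n,k}(x;q,t)$ be the coefficient of $z^{n-k-1}$ in $$\sum_{P} q^{\mathrm{dinv}(P)}\,t^{\mathrm{area}(P)}\prod_{i\in \mathrm{Val}(P)}\bigl(1+z/q^{\,d_i(P)+1}\bigr)\,x^P,$$ where $P$ runs over all labelled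 Dyck paths of order $n$; this is a formal power series in $x=(x_1,x_2,\dots)$. For a composition $\alpha=(\alpha_1,\dots,\alpha_m)$ of $n$ let $M_\alpha=\sum_{i_1<\cdots<i_m}x_{i_1}^{\alpha_1}\cdots x_{i_m}^{\alpha_m}$ be the monomial quasisymmetric function. **Corollary.** For all integers $n>k\ge 0$, the coefficients of $\mathrm{Val}_{n,k}(x;q,t)$ are polynomials in $q,t$ with integer coefficients, the specializations $\mathrm{Val}_{n,k}(x;q,0)$ and $\mathrm{Val}_{n,k}(x;0,q)$ (that is, $(q,t)\mapsto(q,0)$ and $(q,t)\mapsto(0,q)$) are linear combinations over $\mathbb{Z}[q]$ of the $M_\alpha$ with $\alpha$ a composition of $n$, and the coefficient of $M_{(1^n)}$ is the same in both. -/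

import Mathlib

/-- A labelled Dyck path of order `n`. The Dyck path (from `(0,0)` to `(n,n)`, weakly above the
diagonal) is encoded by its area sequence: `area i` is the number of full cells between the path
and the diagonal in row `i`, rows being counted from the bottom. The north step of row `i` carries
the positive integer `label i`, and labels strictly increase up each column (rows `i` and `i + 1`
have their north steps in the same column exactly when `area (i + 1) = area i + 1`). -/
@[ext]
structure LabelledDyckPath (n : ℕ) where
  area : Fin n → ℕ
  label : Fin n → ℕ+
  area_zero : ∀ i : Fin n, i.val = 0 → area i = 0
  area_step : ∀ i j : Fin n, j.val = i.val + 1 → area j ≤ area i + 1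
  label_lt : ∀ i j : Fin n, j.val = i.val + 1 → area j = area i + 1 → label i < label j

namespace LabelledDyckPath

variable {n : ℕ}

/-- The statistic `area(P)`: the sum of the area sequence. -/
def totalArea (P : LabelledDyckPath n) : ℕ := ∑ i, P.area i

/-- `d_i(P)`: the number of diagonal inversions (primary or secondary) whose lower row is `i`. -/
def d (P : LabelledDyckPath n) (i : Fin n) : ℕ :=
  (Finset.univ.filter fun j : Fin n => i < j ∧
    ((P.area i = P.area j ∧ P.label i < P.label j) ∨
      (P.area i = P.area j + 1 ∧ P.label j < P.label i))).card

/-- `dinv(P)`: the number of diagonal inversions. -/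
def dinv (P : LabelledDyckPath n) : ℕ := ∑ i, P.d i

/-- `Val(P)`: the (contractible) valleys. -/
def valleys (P : LabelledDyckPath n) : Finset (Fin n) :=
  Finset.univ.filter fun i : Fin n => ∃ j : Fin n, i.val = j.val + 1 ∧
    (P.area i < P.area j ∨ (P.area i = P.area j ∧ P.label j < P.label i))

/-- The exponent vector of the monomial `x^P`, the product over the rows of `x_{label i}`. -/
noncomputable def weight (P : LabelledDyckPath n) : ℕ+ →₀ ℕ :=
  ∑ i, Finsupp.single (P.label i) 1

theorem area_le (P : LabelledDyckPath n) (i : Fin n) : P.area i ≤ i.val := by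
  obtain ⟨i, hi⟩ := i
  induction i with
  | zero => exact (P.area_zero _ rfl).le
  | succ m ih =>
    have h1 := P.area_step ⟨m, by omega⟩ ⟨m + 1, hi⟩ rfl
    have h2 := ih (by omega)
    simp only at h2 ⊢
    omega

theorem label_mem_support (P : LabelledDyckPath n) (i : Fin n) :
    P.label i ∈ P.weight.support := by
  rw [Finsupp.mem_support_iff, weight, Finsupp.finsetSum_apply]
  intro h
  have := (Finset.sum_eq_zero_iff.mp h) i (Finset.mem_univ i)
  simp at this

/-- Only finitely many labelled Dyck paths of order `n` have a given weight. -/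
theorem finite_weight (n : ℕ) (e : ℕ+ →₀ ℕ) :
    {P : LabelledDyckPath n | P.weight = e}.Finite := by
  classical
  let f : LabelledDyckPath n → (Fin n → ℕ) × (Fin n → ℕ+) := fun P => (P.area, P.label)
  have hf : Function.Injective f := by
    intro P Q h
    exact LabelledDyckPath.ext (congrArg Prod.fst h) (congrArg Prod.snd h)
  refine Set.Finite.of_finite_image (f := f) ?_ hf.injOn
  refine Set.Finite.subset (Set.Finite.prod
    (Set.Finite.pi' (t := fun _ : Fin n => (Set.Iic n : Set ℕ)) fun _ => Set.finite_Iic n)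
    (Set.Finite.pi' (t := fun _ : Fin n => (e.support : Set ℕ+)) fun _ => e.support.finite_toSet))
    ?_
  rintro _ ⟨P, hP, rfl⟩
  refine ⟨fun i => (P.area_le i).trans i.isLt.le, fun i => ?_⟩
  have := P.label_mem_support i
  rw [hP] at this
  exact this

/-- The summand
`q ^ dinv(P) * t ^ area(P) * ∏_{i ∈ Val(P)} (1 + z / q ^ (d_i(P) + 1))`
as a polynomial in `z` over `ℤ[t][q, q⁻¹]`. Here `z` is `Polynomial.X`, the variable of the Laurent
polynomials is `q`, and `t` is the variable of their coefficient ring. -/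
noncomputable def zTerm (P : LabelledDyckPath n) :
    Polynomial (LaurentPolynomial (Polynomial ℤ)) :=
  Polynomial.C (LaurentPolynomial.T (P.dinv : ℤ) *
      LaurentPolynomial.C ((Polynomial.X : Polynomial ℤ) ^ P.totalArea)) *
    ∏ i ∈ P.valleys,
      (1 + Polynomial.X * Polynomial.C
        (LaurentPolynomial.T (-((P.d i : ℤ) + 1)) : LaurentPolynomial (Polynomial ℤ)))

end LabelledDyckPath

/-- `Val_{n,k}(x; q, t)`: the coefficient of `z ^ (n - k - 1)` in the sum of `zTerm P * x^P` over
all labelled Dyck paths `P` of order `n` (meaningful for `k < n`), as a formal power series in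
`x_1, x_2, …` over `ℤ[t][q, q⁻¹]`. -/
noncomputable def valSeries (n k : ℕ) :
    MvPowerSeries ℕ+ (LaurentPolynomial (Polynomial ℤ)) :=
  fun e => (∑ P ∈ (LabelledDyckPath.finite_weight n e).toFinset, P.zTerm).coeff (n - k - 1)

/-- The inclusion `ℤ[t][q] → ℤ[t][q, q⁻¹]`, applied to coefficients. -/
noncomputable def toLaurentSeries :
    MvPowerSeries ℕ+ (Polynomial (Polynomial ℤ)) →+*
      MvPowerSeries ℕ+ (LaurentPolynomial (Polynomial ℤ)) :=
  MvPowerSeries.map Polynomial.toLaurent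

/-- The specialization `(q, t) ↦ (q, 0)` of a power series over `ℤ[t][q]`, with values over
`ℤ[q]`. -/
noncomputable def specQZero :
    MvPowerSeries ℕ+ (Polynomial (Polynomial ℤ)) →+* MvPowerSeries ℕ+ (Polynomial ℤ) :=
  MvPowerSeries.map (Polynomial.mapRingHom (Polynomial.evalRingHom (0 : ℤ)))

/-- The specialization `(q, t) ↦ (0, q)` of a power series over `ℤ[t][q]`, with values over
`ℤ[q]`: put `q = 0`, then read the remaining variable `t` as `q`. -/
noncomputable def specZeroQ :
    MvPowerSeries ℕ+ (Polynomial (Polynomial ℤ)) →+* MvPowerSeries ℕ+ (Polynomial ℤ) :=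
  MvPowerSeries.map (Polynomial.evalRingHom (0 : Polynomial ℤ))

open Classical in
/-- The monomial quasisymmetric function `M_α`, the sum of
`x_{i_1} ^ α_1 ⋯ x_{i_m} ^ α_m` over all `i_1 < ⋯ < i_m`. -/
noncomputable def monomialQSym {n : ℕ} (α : Composition n) :
    MvPowerSeries ℕ+ (Polynomial ℤ) :=
  fun e => if ∃ i : Fin α.length → ℕ+, StrictMono i ∧
    e = ∑ j, Finsupp.single (i j) (α.blocksFun j) then 1 else 0

/-- `f = ∑_α c_α M_α`, the sum being over the compositions `α` of `n`. -/
def IsMonomialExpansion {n : ℕ} (f : MvPowerSeries ℕ+ (Polynomial ℤ))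
    (c : Composition n → Polynomial ℤ) : Prop :=
  f = ∑ α : Composition n, c α • monomialQSym α

/-!
Fix an integer `N` larger than all labels and give row `i` of a labelled Dyck path the height
`c i = N * (area i + 1) - label i`. A pair `i < j` is a diagonal inversion if and only if
`c j < c i < c j + N`, row `i` is a valley if and only if `c i < c (i - 1)`, and the sequences of
heights are those with `c i > 0`, first entry less than `N`, and `c i < c (i - 1) + N`.

*Polynomiality.* The coefficient of `z ^ b` is a sum over sets `S` of `b` valleys, with the exponent
`dinv - ∑_{i ∈ S} (d i + 1)` of `q`. Counting inversions by their upper row, this exponent is the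
number of inversions with lower row outside `S`, minus `b`. If row `i` is a valley, then the first
row higher than `i` is not a valley and forms an inversion with `i`
(`IsHeightSeq.exists_nonvalley_inv`), so the exponent is nonnegative. It is zero only if `S` is the
set of all valleys and the path is tight: each valley has exactly one inversion with a lower row which
is not a valley, and each other row has none.

*Quasisymmetry.* Increasing relabellings change neither the statistics nor the valleys, so the
coefficient of a monomial depends only on its sequence of nonzero exponents. The coefficient of
`M_(1^n)` is then that of `x_1 ⋯ x_n`, and only paths with labels `1, …, n` matter.

*Equality.* Both specializations, as generating functions in `q` and `z`, equal `rankPoly n 0`,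
where `rankPoly` is defined by a recursion on the number of letters.

At `t = 0` the sum is over permutations, with a factor `q ^ d (1 + z / q ^ (d + 1))` for each ascent
and `q ^ d` for every other letter, `d` being the number of later larger letters. Removing the first
letter gives the recursion (`exists_sum_prod_letterFactor`).

At `q = 0` the sum is over tight paths. Take `N = n + 1`. In a tight path the rows which are not
valleys are the left-to-right maxima. The path is determined by the set `X` of heights and the set
`U` of heights of the maxima (`IsTight.ext`), and the pairs `(X, U)` that occur are those for which
`X` is a set of positive integers representing each nonzero residue class modulo `N` once, `U`
contains the maximum of `X`, and the elements of `U`, preceded by `0`, have gaps smaller than `N`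
(`IsMarkedTransversal.exists_isTight`). The area is the sum of the quotients `x / N`. Split `X` into
blocks, each ending at an element of `U`. Read block by block, each block downwards, the pair is
again a word: a mark `w` following the mark `u` contributes `q` to the number of remaining residue
classes met between `u` and `w`, because measuring the quotients from `w` instead of `u` lowers
them by one for these classes, and an unmarked element contributes `z / q`. This is the same
recursion (`exists_sum_transversalWeight`).
-/

/-! ### Height sequences -/

/-- The conditions satisfied by the heights `N * (area i + 1) - label i` of the rows of a labelled
Dyck path whose labels are smaller than `N`. -/
structure IsHeightSeq {n : ℕ} (N : ℤ) (c : Fin n → ℤ) : Prop where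
  pos : ∀ i, 0 < c i
  first : ∀ i : Fin n, i.val = 0 → c i < N
  step : ∀ i j : Fin n, j.val = i.val + 1 → c j < c i + N

/-- Diagonal inversions in terms of heights. -/
def HeightInv {n : ℕ} (N : ℤ) (c : Fin n → ℤ) (j i : Fin n) : Prop :=
  j < i ∧ c i < c j ∧ c j < c i + N

open Classical in
/-- Valleys in terms of heights: the descents of the height sequence. -/
noncomputable def heightValleys {n : ℕ} (c : Fin n → ℤ) : Finset (Fin n) :=
  Finset.univ.filter fun i : Fin n => ∃ j : Fin n, i.val = j.val + 1 ∧ c i < c j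

open Classical in
/-- The number of diagonal inversions with upper row `i` whose lower row lies outside `S`. -/
noncomputable def inversionsOutside {n : ℕ} (N : ℤ) (c : Fin n → ℤ) (S : Finset (Fin n))
    (i : Fin n) : ℕ :=
  (Finset.univ.filter fun j : Fin n => j ∉ S ∧ HeightInv N c j i).card

theorem mem_heightValleys {n : ℕ} {c : Fin n → ℤ} {i : Fin n} :
    i ∈ heightValleys c ↔ ∃ j : Fin n, i.val = j.val + 1 ∧ c i < c j := by
  simp [heightValleys]

namespace IsHeightSeq

variable {n : ℕ} {N : ℤ} {c : Fin n → ℤ}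

/-- If some earlier row is higher than row `i`, then the first such row is not a valley and forms a
diagonal inversion with `i`: the heights cannot jump over the window of length `N` above `c i`. -/
theorem exists_nonvalley_inv (h : IsHeightSeq N c) {i j₀ : Fin n} (hj : j₀ < i)
    (hc : c i < c j₀) : ∃ j, j ∉ heightValleys c ∧ HeightInv N c j i := by
  classical
  obtain ⟨j, hjm, hmin⟩ := (Finset.univ.filter fun j : Fin n => j < i ∧ c i < c j).exists_minimal
    ⟨j₀, by simp [hj, hc]⟩
  simp only [Finset.mem_filter, Finset.mem_univ, true_and] at hjm hmin
  have hlow : ∀ k : Fin n, k < j → c k ≤ c i := by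
    intro k hk
    by_contra! hlt
    exact absurd (hmin ⟨hk.trans hjm.1, hlt⟩ hk.le) (not_le.mpr hk)
  refine ⟨j, ?_, hjm.1, hjm.2, ?_⟩
  · rw [mem_heightValleys]
    rintro ⟨k, hk, hck⟩
    have := hlow k (Fin.lt_def.mpr (by omega))
    have := hjm.2
    omega
  · rcases Nat.eq_zero_or_pos j.val with h0 | h0
    · have := h.first j h0
      have := h.pos i
      omega
    · have hk : (⟨j.val - 1, by omega⟩ : Fin n) < j := Fin.lt_def.mpr (by simp only; omega)
      have := h.step ⟨j.val - 1, by omega⟩ j (by simp only; omega)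
      have := hlow _ hk
      omega

theorem one_le_inversionsOutside (h : IsHeightSeq N c) {S : Finset (Fin n)}
    (hS : S ⊆ heightValleys c) {i : Fin n} (hi : i ∈ heightValleys c) :
    1 ≤ inversionsOutside N c S i := by
  classical
  obtain ⟨k, hk, hck⟩ := mem_heightValleys.mp hi
  obtain ⟨j, hj, hinv⟩ := h.exists_nonvalley_inv (Fin.lt_def.mpr (by omega)) hck
  exact Finset.card_pos.mpr ⟨j, by simpa using ⟨fun hjS => hj (hS hjS), hinv⟩⟩

theorem card_le_sum_inversionsOutside (h : IsHeightSeq N c) {S : Finset (Fin n)}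
    (hS : S ⊆ heightValleys c) : S.card ≤ ∑ i, inversionsOutside N c S i := by
  classical
  calc S.card = ∑ i ∈ S, 1 := by simp
    _ ≤ ∑ i ∈ S, inversionsOutside N c S i :=
        Finset.sum_le_sum fun i hi => h.one_le_inversionsOutside hS (hS hi)
    _ ≤ _ := Finset.sum_le_sum_of_subset (Finset.subset_univ _)

end IsHeightSeq

/-- A height sequence is tight if its valleys are in exactly one diagonal inversion, and its other
rows in none, as the upper row over a row that is not a valley. -/
def IsTight {n : ℕ} (N : ℤ) (c : Fin n → ℤ) : Prop :=
  ∀ i, inversionsOutside N c (heightValleys c) i = if i ∈ heightValleys c then 1 else 0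

theorem IsHeightSeq.sum_inversionsOutside_eq_card_iff {n : ℕ} {N : ℤ} {c : Fin n → ℤ}
    (h : IsHeightSeq N c) {S : Finset (Fin n)} (hS : S ⊆ heightValleys c) :
    ∑ i, inversionsOutside N c S i = S.card ↔ S = heightValleys c ∧ IsTight N c := by
  classical
  constructor
  · intro he
    have hle : ∀ i ∈ Finset.univ,
        (if i ∈ heightValleys c then 1 else 0) ≤ inversionsOutside N c S i := by
      intro i _
      split_ifs with hi
      · exact h.one_le_inversionsOutside hS hi
      · exact Nat.zero_le _
    have h1 := Finset.sum_le_sum hle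
    have h2 : (∑ i : Fin n, if i ∈ heightValleys c then 1 else 0) = (heightValleys c).card := by
      simp
    have hSV : S = heightValleys c := Finset.eq_of_subset_of_card_le hS (by omega)
    refine ⟨hSV, fun i => ?_⟩
    subst hSV
    exact ((Finset.sum_eq_sum_iff_of_le hle).mp (by omega) i (Finset.mem_univ i)).symm
  · rintro ⟨rfl, ht⟩
    rw [Finset.sum_congr rfl fun i _ => ht i]
    simp

namespace LabelledDyckPath

variable {n : ℕ}

/-- The height of a row. It combines area and label in one integer, so that diagonal inversions,
valleys and the defining conditions of a path become inequalities between heights. -/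
def height (N : ℤ) (P : LabelledDyckPath n) (i : Fin n) : ℤ :=
  N * (P.area i + 1) - (P.label i : ℕ)

theorem isHeightSeq_height {N : ℤ} (P : LabelledDyckPath n)
    (hN : ∀ i, ((P.label i : ℕ) : ℤ) < N) : IsHeightSeq N (P.height N) where
  pos i := by
    have := hN i
    have : 0 < (P.label i : ℕ) := (P.label i).pos
    simp only [height]
    nlinarith [Nat.cast_nonneg (α := ℤ) (P.area i)]
  first i hi := by
    have : 0 < (P.label i : ℕ) := (P.label i).pos
    simp only [height, P.area_zero i hi]
    push_cast
    linarith
  step i j hij := by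
    have hi := hN i
    have hj : 0 < (P.label j : ℕ) := (P.label j).pos
    have hN0 : 0 < N := by omega
    have h1 := P.area_step i j hij
    simp only [height]
    rcases h1.eq_or_lt with h2 | h2
    · have h3 : (P.label i : ℕ) < (P.label j : ℕ) := P.label_lt i j hij h2
      rw [h2]
      push_cast
      nlinarith
    · have : (P.area j : ℤ) ≤ P.area i := by omega
      nlinarith

theorem heightInv_height {N : ℤ} (P : LabelledDyckPath n)
    (hN : ∀ i, ((P.label i : ℕ) : ℤ) < N) (i j : Fin n) :
    HeightInv N (P.height N) i j ↔ i < j ∧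
      ((P.area i = P.area j ∧ P.label i < P.label j) ∨
        (P.area i = P.area j + 1 ∧ P.label j < P.label i)) := by
  have hi := hN i
  have hj := hN j
  have hi0 : 0 < (P.label i : ℕ) := (P.label i).pos
  have hj0 : 0 < (P.label j : ℕ) := (P.label j).pos
  have hN0 : 0 < N := by omega
  simp only [HeightInv, height, ← PNat.coe_lt_coe]
  refine and_congr_right fun _ => ?_
  constructor
  · rintro ⟨h1, h2⟩
    have h3 : (P.area j : ℤ) < P.area i + 1 := by
      by_contra! h
      nlinarith
    have h4 : (P.area i : ℤ) < P.area j + 2 := by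
      by_contra! h
      nlinarith
    rcases (show P.area i = P.area j ∨ P.area i = P.area j + 1 by omega) with h | h
    · left
      rw [h] at h1
      exact ⟨h, by omega⟩
    · right
      rw [h] at h2
      push_cast at h2
      refine ⟨h, ?_⟩
      have : ((P.label j : ℕ) : ℤ) < (P.label i : ℕ) := by linarith
      exact_mod_cast this
  · rintro (⟨h1, h2⟩ | ⟨h1, h2⟩)
    · rw [h1]
      constructor <;> linarith [(Nat.cast_lt (α := ℤ)).mpr h2]
    · rw [h1]
      push_cast
      constructor <;> linarith [(Nat.cast_lt (α := ℤ)).mpr h2]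

theorem heightValleys_height {N : ℤ} (P : LabelledDyckPath n)
    (hN : ∀ i, ((P.label i : ℕ) : ℤ) < N) : heightValleys (P.height N) = P.valleys := by
  ext i
  simp only [mem_heightValleys, valleys, Finset.mem_filter, Finset.mem_univ, true_and]
  refine exists_congr fun j => and_congr_right fun hij => ?_
  have hi := hN i
  have hj := hN j
  have hi0 : 0 < (P.label i : ℕ) := (P.label i).pos
  have hj0 : 0 < (P.label j : ℕ) := (P.label j).pos
  have hN0 : 0 < N := by omega
  simp only [height, ← PNat.coe_lt_coe]
  have h1 := P.area_step j i hij
  constructor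
  · intro h
    rcases h1.eq_or_lt with h2 | h2
    · rw [h2] at h
      push_cast at h
      linarith
    · rcases (Nat.lt_succ_iff.mp h2).eq_or_lt with h3 | h3
      · rw [h3] at h
        exact Or.inr ⟨h3, by omega⟩
      · exact Or.inl h3
  · rintro (h | ⟨h2, h3⟩)
    · have : (P.area i : ℤ) + 1 ≤ P.area j := by omega
      nlinarith
    · rw [h2]
      linarith [(Nat.cast_lt (α := ℤ)).mpr h3]

/-- Counting diagonal inversions by their upper instead of their lower row. -/
theorem sum_d_compl {N : ℤ} (P : LabelledDyckPath n)
    (hN : ∀ i, ((P.label i : ℕ) : ℤ) < N) (S : Finset (Fin n)) :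
    ∑ i ∈ Sᶜ, P.d i = ∑ i, inversionsOutside N (P.height N) S i := by
  classical
  have h1 : ∀ i, P.d i = ∑ j, if HeightInv N (P.height N) i j then 1 else 0 := by
    intro i
    rw [d, Finset.card_filter]
    refine Finset.sum_congr rfl fun j _ => ?_
    simp only [P.heightInv_height hN]
  have h2 : ∀ i, inversionsOutside N (P.height N) S i =
      ∑ j ∈ Sᶜ, if HeightInv N (P.height N) j i then 1 else 0 := by
    intro i
    rw [inversionsOutside, ← Finset.card_filter]
    congr 1
    ext j
    simp
  simp only [h1, h2]
  exact Finset.sum_comm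

theorem exists_label_bound (P : LabelledDyckPath n) :
    ∃ N : ℤ, ∀ i, ((P.label i : ℕ) : ℤ) < N := by
  refine ⟨∑ i, ((P.label i : ℕ) : ℤ) + 1, fun i => ?_⟩
  have := Finset.single_le_sum (f := fun i => ((P.label i : ℕ) : ℤ))
    (fun _ _ => Int.natCast_nonneg _) (Finset.mem_univ i)
  omega

theorem sum_d_add_one_add (P : LabelledDyckPath n) (S : Finset (Fin n)) :
    ∑ i ∈ S, (P.d i + 1) + ∑ i ∈ Sᶜ, P.d i = P.dinv + S.card := by
  rw [dinv, ← Finset.sum_add_sum_compl S, Finset.sum_add_distrib]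
  simp
  omega

/-- The exponents of `q` in `zTerm P` are nonnegative. -/
theorem sum_d_add_one_le_dinv (P : LabelledDyckPath n) {S : Finset (Fin n)}
    (hS : S ⊆ P.valleys) : ∑ i ∈ S, (P.d i + 1) ≤ P.dinv := by
  obtain ⟨N, hN⟩ := P.exists_label_bound
  have h1 := (P.isHeightSeq_height hN).card_le_sum_inversionsOutside
    (S := S) (by rwa [P.heightValleys_height hN])
  rw [← P.sum_d_compl hN] at h1
  have := P.sum_d_add_one_add S
  omega

/-- The exponent of `q` vanishes only for `S` the set of all valleys and a tight path. -/
theorem dinv_sub_eq_zero_iff {N : ℤ} (P : LabelledDyckPath n)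
    (hN : ∀ i, ((P.label i : ℕ) : ℤ) < N) {S : Finset (Fin n)} (hS : S ⊆ P.valleys) :
    P.dinv - ∑ i ∈ S, (P.d i + 1) = 0 ↔ S = P.valleys ∧ IsTight N (P.height N) := by
  rw [← P.heightValleys_height hN] at hS ⊢
  rw [← (P.isHeightSeq_height hN).sum_inversionsOutside_eq_card_iff hS, ← P.sum_d_compl hN]
  have := P.sum_d_add_one_add S
  have := P.sum_d_add_one_le_dinv (S := S) (by rwa [← P.heightValleys_height hN])
  omega

end LabelledDyckPath

/-! ### Tight height sequences and chains of marked integers -/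

/-- A marked transversal: a finite set `X` of integers, one in each residue class in `R`, with a set
`U` of marked elements. The elements of `X` are the unmarked ones in the interval `(lo, y)` and the
ones above `u`; every one above `u` has a marked element above it or is marked, and the marked
elements form a chain starting above `u` with steps smaller than `N`. -/
structure IsMarkedTransversal (N : ℕ) (R : Finset (ZMod N)) (lo y u : ℤ) (X U : Finset ℤ) :
    Prop where
  subset : U ⊆ X
  injOn : Set.InjOn (fun x : ℤ => (x : ZMod N)) X
  image : X.image (fun x : ℤ => (x : ZMod N)) = R
  range : ∀ x ∈ X, (lo < x ∧ x < y ∧ x ∉ U) ∨ u < x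
  top : ∀ x ∈ X, u < x → ∃ v ∈ U, x ≤ v
  chain : ∀ v ∈ U, ∃ w ∈ insert u U, w < v ∧ v < w + N

section Tight

variable {n : ℕ} {N : ℕ} {c : Fin n → ℤ}

/-- In a tight height sequence the rows which are not valleys are left-to-right maxima. -/
theorem IsTight.lt_of_lt (h : IsHeightSeq N c) (ht : IsTight N c) (hc : Function.Injective c)
    {i j : Fin n} (hi : i ∉ heightValleys c) (hji : j < i) : c j < c i := by
  classical
  by_contra! hle
  have hlt : c i < c j := lt_of_le_of_ne hle fun e => hji.ne (hc e.symm)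
  obtain ⟨k, hk, hinv⟩ := h.exists_nonvalley_inv hji hlt
  have h0 := ht i
  rw [if_neg hi, inversionsOutside, Finset.card_eq_zero] at h0
  have : k ∈ Finset.univ.filter fun j : Fin n =>
      j ∉ heightValleys c ∧ HeightInv N c j i := by simpa using ⟨hk, hinv⟩
  simp [h0] at this

theorem IsTight.eq_of_inv (ht : IsTight N c) {i j k : Fin n}
    (hj : j ∉ heightValleys c) (hji : HeightInv N c j i)
    (hk : k ∉ heightValleys c) (hki : HeightInv N c k i) : j = k := by
  classical
  have h0 := ht i
  have : inversionsOutside N c (heightValleys c) i ≤ 1 := by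
    rw [h0]; split_ifs <;> omega
  exact Finset.card_le_one.mp this j (by simpa using ⟨hj, hji⟩) k (by simpa using ⟨hk, hki⟩)

/-- The last row up to `i` which is not a valley is the highest row up to `i`. -/
theorem IsTight.exists_last_nonvalley (h : IsHeightSeq N c) (ht : IsTight N c)
    (hc : Function.Injective c) (i : Fin n) :
    ∃ j ≤ i, j ∉ heightValleys c ∧ (∀ k ≤ i, c k ≤ c j) ∧
      ∀ k, j < k → k ≤ i → k ∈ heightValleys c := by
  obtain ⟨i, hin⟩ := i
  induction i with
  | zero =>
    refine ⟨⟨0, hin⟩, le_rfl, ?_, ?_, ?_⟩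
    · rw [mem_heightValleys]
      rintro ⟨j, hj, -⟩
      simp at hj
    · intro k hk
      rw [show k = ⟨0, hin⟩ from le_antisymm hk (Fin.le_def.mpr (Nat.zero_le _))]
    · intro k h1 h2
      exact absurd h1 (not_lt.mpr h2)
  | succ m ih =>
    by_cases hv : (⟨m + 1, hin⟩ : Fin n) ∈ heightValleys c
    · obtain ⟨j, hjm, hj, hmax, hlast⟩ := ih (by omega)
      obtain ⟨p, hp, hcp⟩ := mem_heightValleys.mp hv
      have hpm : p = ⟨m, by omega⟩ := Fin.ext (by simp only at hp ⊢; omega)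
      rw [Fin.le_def] at hjm
      refine ⟨j, Fin.le_def.mpr (by simp only at hjm ⊢; omega), hj, ?_, ?_⟩
      · intro k hk
        rcases hk.eq_or_lt with rfl | hk
        · exact hcp.le.trans (hpm ▸ hmax _ le_rfl)
        · exact hmax k (Fin.le_def.mpr (by rw [Fin.lt_def] at hk; simp only at hk ⊢; omega))
      · intro k h1 hk
        rcases hk.eq_or_lt with rfl | hk
        · exact hv
        · exact hlast k h1 (Fin.le_def.mpr (by rw [Fin.lt_def] at hk; simp only at hk ⊢; omega))
    · refine ⟨_, le_rfl, hv, ?_, ?_⟩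
      · intro k hk
        rcases hk.eq_or_lt with rfl | hk
        · exact le_rfl
        · exact (ht.lt_of_lt h hc hv hk).le
      · intro k h1 h2
        exact absurd h1 (not_lt.mpr h2)

/-- The set of heights of a height sequence. -/
noncomputable def heightSet (c : Fin n → ℤ) : Finset ℤ := Finset.univ.image c

/-- The set of heights of the rows which are not valleys. -/
noncomputable def markedHeights (c : Fin n → ℤ) : Finset ℤ := (heightValleys c)ᶜ.image c

theorem mem_heightSet {x : ℤ} : x ∈ heightSet c ↔ ∃ i, c i = x := by simp [heightSet]

theorem mem_markedHeights {x : ℤ} :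
    x ∈ markedHeights c ↔ ∃ i, i ∉ heightValleys c ∧ c i = x := by simp [markedHeights]

/-- Marked heights are chained: a record exceeds the preceding row, hence the preceding record, by
less than `N`. -/
theorem IsTight.isMarkedTransversal (h : IsHeightSeq N c) (ht : IsTight N c)
    (hc : Function.Injective fun i => (c i : ZMod N)) :
    IsMarkedTransversal N (Finset.univ.image fun i => (c i : ZMod N)) 0 0 0
      (heightSet c) (markedHeights c) := by
  have hc' : Function.Injective c := Function.Injective.of_comp (f := fun x : ℤ => (x : ZMod N)) hc
  refine ⟨?_, ?_, ?_, ?_, ?_, ?_⟩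
  · intro x hx
    obtain ⟨i, -, rfl⟩ := mem_markedHeights.mp hx
    exact mem_heightSet.mpr ⟨i, rfl⟩
  · intro x hx y hy hxy
    obtain ⟨i, rfl⟩ := mem_heightSet.mp hx
    obtain ⟨j, rfl⟩ := mem_heightSet.mp hy
    rw [hc hxy]
  · rw [heightSet, Finset.image_image]
    rfl
  · intro x hx
    obtain ⟨i, rfl⟩ := mem_heightSet.mp hx
    exact Or.inr (h.pos i)
  · intro x hx _
    obtain ⟨i, rfl⟩ := mem_heightSet.mp hx
    obtain ⟨j, -, hj, hmax, -⟩ := ht.exists_last_nonvalley h hc' i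
    exact ⟨c j, mem_markedHeights.mpr ⟨j, hj, rfl⟩, hmax i le_rfl⟩
  · intro v hv
    obtain ⟨i, hi, rfl⟩ := mem_markedHeights.mp hv
    rcases Nat.eq_zero_or_pos i.val with h0 | h0
    · exact ⟨0, Finset.mem_insert_self _ _, h.pos i, by simpa using h.first i h0⟩
    · let p : Fin n := ⟨i.val - 1, by omega⟩
      have hpi : p < i := Fin.lt_def.mpr (by simp only [p]; omega)
      have hstep := h.step p i (by simp only [p]; omega)
      obtain ⟨j, hjp, hj, hmax, -⟩ := ht.exists_last_nonvalley h hc' p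
      have := hmax p le_rfl
      exact ⟨c j, Finset.mem_insert_of_mem (mem_markedHeights.mpr ⟨j, hj, rfl⟩),
        ht.lt_of_lt h hc' hi (hjp.trans_lt hpi), by omega⟩

end Tight

/-! ### Recovering the order of the rows -/

/-- The marks at or above `x` that are maximal or are followed by a mark less than `x + N`. -/
def gateSet (N : ℕ) (U : Finset ℤ) (x : ℤ) : Set ℤ :=
  {v | v ∈ U ∧ x ≤ v ∧ ((∀ w ∈ U, w ≤ v) ∨ ∃ w ∈ U, v < w ∧ w < x + N)}

/-- The gate of a height `x`: the last mark at or before the row of height `x` in the tight height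
sequence with marked heights `U`. -/
noncomputable def gate (N : ℕ) (U : Finset ℤ) (x : ℤ) : ℤ := sInf (gateSet N U x)

/-- The rows of a tight height sequence are sorted by gate, and by decreasing height within each
gate. -/
noncomputable def rowKey (N : ℕ) (U : Finset ℤ) (x : ℤ) : ℤ ×ₗ ℤ := toLex (gate N U x, -x)

theorem rowKey_lt_iff {N : ℕ} {U : Finset ℤ} {x y : ℤ} : rowKey N U x < rowKey N U y ↔
    gate N U x < gate N U y ∨ gate N U x = gate N U y ∧ y < x := by
  simp [rowKey, Prod.Lex.toLex_lt_toLex]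

theorem rowKey_le_iff {N : ℕ} {U : Finset ℤ} {x y : ℤ} : rowKey N U x ≤ rowKey N U y ↔
    gate N U x < gate N U y ∨ gate N U x = gate N U y ∧ y ≤ x := by
  simp [rowKey, Prod.Lex.toLex_le_toLex]

theorem rowKey_injective (N : ℕ) (U : Finset ℤ) : Function.Injective (rowKey N U) := by
  intro x y h
  have := congrArg (fun p => (ofLex p).2) h
  simpa [rowKey] using this

section Tight

variable {n : ℕ} {N : ℕ} {c : Fin n → ℤ}

/-- The gate of a row of a tight height sequence is the height of the last row up to it which is not
a valley. -/
theorem IsTight.isLeast_gateSet (h : IsHeightSeq N c) (ht : IsTight N c)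
    (hc : Function.Injective c) {i j : Fin n} (hji : j ≤ i) (hj : j ∉ heightValleys c)
    (hmax : ∀ k ≤ i, c k ≤ c j) (hlast : ∀ k, j < k → k ≤ i → k ∈ heightValleys c) :
    IsLeast (gateSet N (markedHeights c) (c i)) (c j) := by
  classical
  constructor
  · refine ⟨mem_markedHeights.mpr ⟨j, hj, rfl⟩, hmax i le_rfl, ?_⟩
    by_cases hex : ∃ k, i < k ∧ k ∉ heightValleys c
    · right
      obtain ⟨k₀, hk₀⟩ := hex
      obtain ⟨k, hk, hmin⟩ := (Finset.univ.filter fun k : Fin n =>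
        i < k ∧ k ∉ heightValleys c).exists_minimal ⟨k₀, by simpa using hk₀⟩
      simp only [Finset.mem_filter, Finset.mem_univ, true_and] at hk hmin
      refine ⟨c k, mem_markedHeights.mpr ⟨k, hk.2, rfl⟩,
        ht.lt_of_lt h hc hk.2 (hji.trans_lt hk.1), ?_⟩
      -- All rows strictly between `i` and `k` are valleys, so the heights decrease there.
      have hdesc : ∀ m, ∀ hm : m < n, i.val ≤ m → m < k.val → c ⟨m, hm⟩ ≤ c i := by
        intro m hm him
        induction m, him using Nat.le_induction with
        | base => intro _; exact le_rfl
        | succ m him ih =>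
          intro hmk
          have hv : (⟨m + 1, hm⟩ : Fin n) ∈ heightValleys c := by
            by_contra hv
            have := hmin ⟨Fin.lt_def.mpr (by simp only; omega), hv⟩
              (Fin.le_def.mpr (by simp only; omega))
            rw [Fin.le_def] at this
            simp only at this
            omega
          obtain ⟨p, hp, hcp⟩ := mem_heightValleys.mp hv
          have hpm : p = ⟨m, by omega⟩ := Fin.ext (by simp only at hp ⊢; omega)
          have := ih (by omega) (by omega)
          rw [hpm] at hcp
          omega
      have hik := Fin.lt_def.mp hk.1
      have h1 := hdesc (k.val - 1) (by omega) (by omega) (by omega)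
      have h2 := h.step ⟨k.val - 1, by omega⟩ k (by simp only; omega)
      omega
    · left
      push Not at hex
      intro w hw
      obtain ⟨k, hk, rfl⟩ := mem_markedHeights.mp hw
      exact hmax k (not_lt.mp fun hik => hk (hex k hik))
  · rintro v ⟨hv, hle, halt⟩
    by_contra! hlt
    obtain ⟨k, hk, rfl⟩ := mem_markedHeights.mp hv
    have hkj : k < j := by
      by_contra! hjk
      rcases hjk.eq_or_lt with rfl | hjk
      · exact lt_irrefl _ hlt
      · exact absurd (ht.lt_of_lt h hc hk hjk) (not_lt.mpr hlt.le)
    have hki : k < i := hkj.trans_le hji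
    rcases halt with hm | ⟨w, hw, hkw, hwN⟩
    · exact absurd (hm _ (mem_markedHeights.mpr ⟨j, hj, rfl⟩)) (not_le.mpr hlt)
    · have hik : c i < c k := lt_of_le_of_ne hle fun e => hki.ne (hc e).symm
      have hji' : j < i := by
        rcases hji.eq_or_lt with rfl | h'
        · exact absurd hlt (not_lt.mpr hle)
        · exact h'
      obtain ⟨l, hl, rfl⟩ := mem_markedHeights.mp hw
      have hjN : c j < c i + N := by
        by_cases hlj : l ≤ j
        · -- Two marks in the window of `i` would be two inversions over row `i`.
          have := ht.eq_of_inv hk ⟨hki, hik, by omega⟩ hl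
            ⟨hlj.trans_lt hji', by omega, hwN⟩
          subst this
          exact absurd hkw (lt_irrefl _)
        · exact (ht.lt_of_lt h hc hl (not_le.mp hlj)).trans hwN
      exact hkj.ne (ht.eq_of_inv hk ⟨hki, hik, by omega⟩ hj ⟨hji', by omega, hjN⟩)

theorem IsTight.strictMono_rowKey (h : IsHeightSeq N c) (ht : IsTight N c)
    (hc : Function.Injective c) : StrictMono fun i => rowKey N (markedHeights c) (c i) := by
  intro i i' hii'
  obtain ⟨j, hji, hj, hmax, hlast⟩ := ht.exists_last_nonvalley h hc i
  obtain ⟨j', hji', hj', hmax', hlast'⟩ := ht.exists_last_nonvalley h hc i'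
  have hg : gate N (markedHeights c) (c i) = c j :=
    (ht.isLeast_gateSet h hc hji hj hmax hlast).csInf_eq
  have hg' : gate N (markedHeights c) (c i') = c j' :=
    (ht.isLeast_gateSet h hc hji' hj' hmax' hlast').csInf_eq
  simp only [rowKey_lt_iff, hg, hg']
  rcases (hmax' j (hji.trans hii'.le)).lt_or_eq with hlt | heq
  · exact Or.inl hlt
  · right
    refine ⟨heq, ?_⟩
    have hjj := hc heq
    subst hjj
    have hdesc : ∀ m, ∀ hm : m < n, i.val < m → m ≤ i'.val → c ⟨m, hm⟩ < c i := by
      intro m hm him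
      rw [← Nat.succ_le_iff] at him
      have key : ∀ m, ∀ hm : m + 1 < n, i.val ≤ m → m + 1 ≤ i'.val →
          c ⟨m + 1, hm⟩ < c ⟨m, by omega⟩ := by
        intro m hm him hmi
        have hv := hlast' ⟨m + 1, hm⟩
          (hji.trans_lt (Fin.lt_def.mpr (by simp only; omega))) (Fin.le_def.mpr hmi)
        obtain ⟨p, hp, hcp⟩ := mem_heightValleys.mp hv
        have hpm : p = ⟨m, by omega⟩ := Fin.ext (by simp only at hp ⊢; omega)
        rwa [hpm] at hcp
      induction m, him using Nat.le_induction with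
      | base => intro hle; exact key i.val hm le_rfl hle
      | succ m him ih =>
        intro hle
        exact (key m hm (by omega) hle).trans (ih (by omega) (by omega) (by omega))
    exact hdesc i'.val i'.isLt (Fin.lt_def.mp hii') le_rfl

/-- A tight height sequence is determined by its marked set of heights. -/
theorem IsTight.ext {c' : Fin n → ℤ} (h : IsHeightSeq N c) (ht : IsTight N c)
    (hc : Function.Injective c) (h' : IsHeightSeq N c') (ht' : IsTight N c')
    (hc' : Function.Injective c') (hX : heightSet c = heightSet c')
    (hU : markedHeights c = markedHeights c') : c = c' := by
  have h1 := ht.strictMono_rowKey h hc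
  have h2 := ht'.strictMono_rowKey h' hc'
  rw [← hU] at h2
  have h3 : Set.range c = Set.range c' := by
    ext x
    have := Finset.ext_iff.mp hX x
    simpa [mem_heightSet] using this
  have h4 : (fun i => rowKey N (markedHeights c) (c i)) =
      fun i => rowKey N (markedHeights c) (c' i) := by
    rw [← StrictMono.range_inj h1 h2]
    have : ∀ d : Fin n → ℤ, (Set.range fun i => rowKey N (markedHeights c) (d i)) =
        rowKey N (markedHeights c) '' Set.range d := fun d =>
      Set.range_comp (rowKey N (markedHeights c)) d
    rw [this, this, h3]
  funext i
  exact rowKey_injective _ _ (congrFun h4 i)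

end Tight

section Construct

variable {N : ℕ} {R : Finset (ZMod N)} {X U : Finset ℤ}

theorem IsMarkedTransversal.gateSet_nonempty
    (h : IsMarkedTransversal N R 0 0 0 X U) {x : ℤ} (hx : x ∈ X) :
    (gateSet N U x).Nonempty := by
  have hpos : 0 < x := by rcases h.range x hx with h | h <;> omega
  obtain ⟨v, hv, hxv⟩ := h.top x hx hpos
  exact ⟨U.max' ⟨v, hv⟩, U.max'_mem _, hxv.trans (U.le_max' v hv),
    Or.inl fun w hw => U.le_max' w hw⟩

theorem IsMarkedTransversal.isLeast_gate
    (h : IsMarkedTransversal N R 0 0 0 X U) {x : ℤ} (hx : x ∈ X) :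
    IsLeast (gateSet N U x) (gate N U x) := by
  have hb : BddBelow (gateSet N U x) := ⟨x, fun v hv => hv.2.1⟩
  exact ⟨Int.csInf_mem (h.gateSet_nonempty hx) hb, fun v hv => csInf_le hb hv⟩

theorem IsMarkedTransversal.gate_eq_self
    (h : IsMarkedTransversal N R 0 0 0 X U) {v : ℤ} (hv : v ∈ U) : gate N U v = v := by
  refine le_antisymm ((h.isLeast_gate (h.subset hv)).2 ⟨hv, le_rfl, ?_⟩)
    (h.isLeast_gate (h.subset hv)).1.2.1
  by_cases hm : ∀ w ∈ U, w ≤ v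
  · exact Or.inl hm
  · right
    push Not at hm
    obtain ⟨w₀, hw₀, hvw₀⟩ := hm
    obtain ⟨w, hw, hmin⟩ := (U.filter fun w => v < w).exists_minimal
      ⟨w₀, by simpa using ⟨hw₀, hvw₀⟩⟩
    simp only [Finset.mem_filter] at hw hmin
    obtain ⟨w', hw', hlt, hN⟩ := h.chain w hw.1
    refine ⟨w, hw.1, hw.2, ?_⟩
    have : w' ≤ v := by
      rcases Finset.mem_insert.mp hw' with rfl | hw'
      · rcases h.range v (h.subset hv) with h | h <;> omega
      · by_contra! hcon
        exact absurd (hmin ⟨hw', hcon⟩ hlt.le) (not_le.mpr hlt)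
    omega

/-- Every marked transversal comes from a tight height sequence: list its elements by increasing
row key. -/
theorem IsMarkedTransversal.exists_isTight
    (h : IsMarkedTransversal N R 0 0 0 X U) {n : ℕ} (hn : X.card = n) :
    ∃ c : Fin n → ℤ, IsHeightSeq N c ∧ IsTight N c ∧ heightSet c = X ∧ markedHeights c = U := by
  classical
  let Y := X.image (rowKey N U)
  have hY : Y.card = n := by rw [Finset.card_image_of_injective _ (rowKey_injective N U), hn]
  let c : Fin n → ℤ := fun i => -(ofLex (Y.orderEmbOfFin hY i)).2
  have hkey : ∀ i, c i ∈ X ∧ rowKey N U (c i) = Y.orderEmbOfFin hY i := by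
    intro i
    obtain ⟨x, hx, hxe⟩ := Finset.mem_image.mp (Y.orderEmbOfFin_mem hY i)
    have : c i = x := by simp [c, ← hxe, rowKey]
    rw [this]
    exact ⟨hx, hxe⟩
  have hmono : StrictMono fun i => rowKey N U (c i) := by
    intro i j hij
    simp only [(hkey _).2]
    exact (Y.orderEmbOfFin hY).strictMono hij
  have hlt : ∀ {i j}, rowKey N U (c i) < rowKey N U (c j) ↔ i < j := hmono.lt_iff_lt
  have hle : ∀ {i j}, rowKey N U (c i) ≤ rowKey N U (c j) ↔ i ≤ j := hmono.le_iff_le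
  have hsurj : ∀ x ∈ X, ∃ i, c i = x := by
    intro x hx
    have : rowKey N U x ∈ Set.range (Y.orderEmbOfFin hY) := by
      rw [Finset.range_orderEmbOfFin]
      exact Finset.mem_coe.mpr (Finset.mem_image_of_mem _ hx)
    obtain ⟨i, hi⟩ := this
    exact ⟨i, rowKey_injective N U ((hkey i).2.trans hi)⟩
  have hpos : ∀ i, 0 < c i := fun i => by
    rcases h.range _ (hkey i).1 with h | h <;> omega
  have hgate := fun i => h.isLeast_gate (hkey i).1
  -- The first row in each gate is the gate itself.
  have hgateRow : ∀ i, ∃ k ≤ i, c k = gate N U (c i) := by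
    intro i
    obtain ⟨k, hk⟩ := hsurj _ (h.subset (hgate i).1.1)
    refine ⟨k, hle.mp ?_, hk⟩
    rw [rowKey_le_iff, hk, h.gate_eq_self (hgate i).1.1]
    exact Or.inr ⟨rfl, (hgate i).1.2.1⟩
  have hfirst : ∀ i : Fin n, i.val = 0 → c i ∈ U := by
    intro i hi
    obtain ⟨k, hki, hk⟩ := hgateRow i
    have : k = i := Fin.ext (by rw [Fin.le_def] at hki; omega)
    subst this
    rw [hk]
    exact (hgate k).1.1
  have hnext : ∀ i j : Fin n, j.val = i.val + 1 →
      gate N U (c i) = gate N U (c j) ∧ c j < c i ∨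
      gate N U (c i) < gate N U (c j) ∧ gate N U (c j) = c j ∧ c j ∈ U := by
    intro i j hij
    rcases rowKey_lt_iff.mp (hlt.mpr (Fin.lt_def.mpr (by omega) : i < j)) with hg | hg
    · right
      obtain ⟨k, hkj, hk⟩ := hgateRow j
      have hik : i < k := by
        rw [← hlt, rowKey_lt_iff, hk, h.gate_eq_self (hgate j).1.1]
        exact Or.inl hg
      have : k = j := Fin.ext (by rw [Fin.le_def] at hkj; rw [Fin.lt_def] at hik; omega)
      subst this
      exact ⟨hg, hk.symm, hk ▸ (hgate k).1.1⟩
    · exact Or.inl hg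
  have hseq : IsHeightSeq N c := by
    refine ⟨hpos, ?_, ?_⟩
    · intro i hi
      obtain ⟨w, hw, hwi, hN⟩ := h.chain _ (hfirst i hi)
      rcases Finset.mem_insert.mp hw with rfl | hw
      · simpa using hN
      · obtain ⟨k, hk⟩ := hsurj w (h.subset hw)
        have : k < i := by
          rw [← hlt, rowKey_lt_iff, hk, h.gate_eq_self hw, h.gate_eq_self (hfirst i hi)]
          exact Or.inl hwi
        rw [Fin.lt_def] at this
        omega
    · intro i j hij
      rcases hnext i j hij with hg | ⟨hg, hj, hjU⟩
      · omega
      · rcases (hgate i).1.2.2 with hm | ⟨w, hw, hgw, hwN⟩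
        · have := hm _ hjU
          omega
        · obtain ⟨k, hk⟩ := hsurj w (h.subset hw)
          have hik : i < k := by
            rw [← hlt, rowKey_lt_iff, hk, h.gate_eq_self hw]
            exact Or.inl hgw
          have hjk : j ≤ k := Fin.le_def.mpr (by rw [Fin.lt_def] at hik; omega)
          have := hle.mpr hjk
          rw [rowKey_le_iff, hk, h.gate_eq_self hw, hj] at this
          omega
  have hval : ∀ i, i ∈ heightValleys c ↔ c i ∉ U := by
    intro i
    rw [mem_heightValleys]
    constructor
    · rintro ⟨j, hij, hc⟩ hU
      have hji := hlt.mpr (Fin.lt_def.mpr (by omega) : j < i)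
      rw [rowKey_lt_iff, h.gate_eq_self hU] at hji
      have := (hgate j).1.2.1
      omega
    · intro hU
      have h0 : i.val ≠ 0 := fun h0 => hU (hfirst i h0)
      refine ⟨⟨i.val - 1, by omega⟩, by simp only; omega, ?_⟩
      rcases hnext ⟨i.val - 1, by omega⟩ i (by simp only; omega) with hg | hg
      · exact hg.2
      · exact absurd hg.2.2 hU
  refine ⟨c, hseq, ?_, ?_, ?_⟩
  · intro i
    split_ifs with hi
    · refine le_antisymm ?_ (hseq.one_le_inversionsOutside subset_rfl hi)
      refine Finset.card_le_one.mpr ?_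
      -- The lower of two marks in the window of `i` would be a gate candidate for `i`, so the
      -- upper one comes after row `i`.
      have key : ∀ j k : Fin n, c j ∈ U → HeightInv N c j i → c k ∈ U → HeightInv N c k i →
          ¬ c j < c k := by
        intro j k hj hji hk hki hjk
        have h1 : gate N U (c i) ≤ c j :=
          (hgate i).2 ⟨hj, hji.2.1.le, Or.inr ⟨c k, hk, hjk, hki.2.2⟩⟩
        have h2 : i < k := by
          rw [← hlt, rowKey_lt_iff, h.gate_eq_self hk]
          exact Or.inl (by omega)
        exact absurd h2 (not_lt.mpr hki.1.le)
      intro j hj k hk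
      simp only [Finset.mem_filter, Finset.mem_univ, true_and, hval, not_not] at hj hk
      have hcjk : c j = c k :=
        le_antisymm (not_lt.mp (key k j hk.1 hk.2 hj.1 hj.2))
          (not_lt.mp (key j k hj.1 hj.2 hk.1 hk.2))
      exact hmono.injective (congrArg (rowKey N U) hcjk)
    · rw [inversionsOutside, Finset.card_eq_zero, Finset.filter_eq_empty_iff]
      rintro j - ⟨hj, hinv⟩
      rw [hval, not_not] at hi hj
      have hji := hlt.mpr hinv.1
      rw [rowKey_lt_iff, h.gate_eq_self hi, h.gate_eq_self hj] at hji
      have := hinv.2.1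
      omega
  · ext x
    rw [mem_heightSet]
    exact ⟨fun ⟨i, hi⟩ => hi ▸ (hkey i).1, hsurj x⟩
  · ext x
    rw [mem_markedHeights]
    constructor
    · rintro ⟨i, hi, rfl⟩
      rwa [hval, not_not] at hi
    · intro hx
      obtain ⟨i, rfl⟩ := hsurj x (h.subset hx)
      exact ⟨i, by rwa [hval, not_not], rfl⟩

end Construct

/-! ### The common generating polynomial -/

open Polynomial in
/-- The common generating polynomial. It counts words in `r` letters, built letter by letter, the
variable of the polynomial marking some of the letters: a plain letter of rank `i` among the
remaining ones contributes `q ^ i`, and a marked letter contributes `q⁻¹` and must have rank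
smaller than the bound `j`. The rank of a letter is the bound for the next one. -/
noncomputable def rankPoly : ℕ → ℕ → (LaurentPolynomial ℤ)[X]
  | 0, _ => 1
  | r + 1, j => ∑ i ∈ Finset.range (r + 1), C (LaurentPolynomial.T (i : ℤ)) * rankPoly r i +
      ∑ i ∈ Finset.range j, X * C (LaurentPolynomial.T (-1)) * rankPoly r i

/-- The ranks of the elements of `A` are `0, …, A.card - 1`. -/
theorem Finset.sum_card_filter_lt {α M : Type*} [LinearOrder α] [AddCommMonoid M] (A : Finset α)
    (f : ℕ → M) : ∑ x ∈ A, f (A.filter (· < x)).card = ∑ i ∈ Finset.range A.card, f i := by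
  induction A using Finset.induction_on_max with
  | empty => simp
  | insert a s hs ih =>
    have ha : a ∉ s := fun h => lt_irrefl _ (hs a h)
    rw [Finset.sum_insert ha, Finset.card_insert_of_notMem ha, Finset.sum_range_succ, ← ih,
      add_comm]
    congr 1
    · refine Finset.sum_congr rfl fun x hx => ?_
      rw [Finset.filter_insert, if_neg (not_lt.mpr (hs x hx).le)]
    · rw [Finset.filter_insert, if_neg (lt_irrefl _), Finset.filter_true_of_mem hs]

theorem Finset.sum_card_filter_gt {α M : Type*} [LinearOrder α] [AddCommMonoid M] (A : Finset α)
    (f : ℕ → M) : ∑ x ∈ A, f (A.filter (x < ·)).card = ∑ i ∈ Finset.range A.card, f i :=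
  Finset.sum_card_filter_lt (α := αᵒᵈ) A f

theorem Int.ediv_sub_ediv_sub {N a d : ℤ} (hd : 0 < d) (hdN : d < N) :
    a / N - (a - d) / N = if a % N < d then 1 else 0 := by
  have hN : 0 < N := hd.trans hdN
  have h1 := Int.emod_nonneg a hN.ne'
  have h2 := Int.emod_lt_of_pos a hN
  have h3 := Int.mul_ediv_add_emod a N
  split_ifs with h
  · have := ((Int.ediv_emod_unique hN (a := a - d) (q := a / N - 1) (r := a % N - d + N)).mpr
      ⟨by linarith, by omega, by omega⟩).1
    omega
  · have := ((Int.ediv_emod_unique hN (a := a - d) (q := a / N) (r := a % N - d)).mpr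
      ⟨by linarith, by omega, by omega⟩).1
    omega

/-! ### The generating polynomial of marked transversals -/

namespace IsMarkedTransversal

variable {N : ℕ} {R : Finset (ZMod N)} {lo y u : ℤ} {X U : Finset ℤ}

theorem cast_mem (h : IsMarkedTransversal N R lo y u X U) {x : ℤ} (hx : x ∈ X) :
    (x : ZMod N) ∈ R := by
  rw [← h.image]
  exact Finset.mem_image_of_mem _ hx

theorem notMem_of_erase {x : ℤ}
    (h : IsMarkedTransversal N (R.erase (x : ZMod N)) lo y u X U) : x ∉ X := fun hx => by
  simpa using h.cast_mem hx

theorem injOn_insert {x : ℤ}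
    (h : IsMarkedTransversal N (R.erase (x : ZMod N)) lo y u X U) :
    Set.InjOn (fun x : ℤ => (x : ZMod N)) (insert x X : Finset ℤ) := by
  rw [Finset.coe_insert, Set.injOn_insert (by simpa using h.notMem_of_erase)]
  refine ⟨h.injOn, ?_⟩
  rintro ⟨z, hz, hzx⟩
  have := h.cast_mem hz
  simp only at hzx
  rw [hzx] at this
  simp at this

theorem image_insert {x : ℤ} (hxR : (x : ZMod N) ∈ R)
    (h : IsMarkedTransversal N (R.erase (x : ZMod N)) lo y u X U) :
    (insert x X).image (fun x : ℤ => (x : ZMod N)) = R := by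
  rw [Finset.image_insert, h.image, Finset.insert_erase hxR]

theorem image_erase (h : IsMarkedTransversal N R lo y u X U) {x : ℤ} (hx : x ∈ X) :
    (X.erase x).image (fun x : ℤ => (x : ZMod N)) = R.erase (x : ZMod N) := by
  ext r
  rw [Finset.mem_erase, ← h.image]
  simp only [Finset.mem_image, Finset.mem_erase]
  constructor
  · rintro ⟨z, ⟨hzx, hz⟩, rfl⟩
    exact ⟨fun e => hzx (h.injOn hz hx e), z, hz, rfl⟩
  · rintro ⟨hne, z, hz, rfl⟩
    exact ⟨z, ⟨fun e => hne (by rw [e]), hz⟩, rfl⟩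

theorem insert_unmarked {x : ℤ} (hlo : lo < x) (hy : x < y) (hyu : y ≤ u)
    (hxR : (x : ZMod N) ∈ R) (h : IsMarkedTransversal N (R.erase (x : ZMod N)) lo x u X U) :
    IsMarkedTransversal N R lo y u (insert x X) U where
  subset := h.subset.trans (Finset.subset_insert _ _)
  injOn := h.injOn_insert
  image := h.image_insert hxR
  range z hz := by
    rcases Finset.mem_insert.mp hz with rfl | hz
    · exact Or.inl ⟨hlo, hy, fun hU => h.notMem_of_erase (h.subset hU)⟩
    · rcases h.range z hz with ⟨h1, h2, h3⟩ | h1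
      · exact Or.inl ⟨h1, h2.trans hy, h3⟩
      · exact Or.inr h1
  top z hz hzu := by
    rcases Finset.mem_insert.mp hz with rfl | hz
    · omega
    · exact h.top z hz hzu
  chain := h.chain

theorem erase_unmarked {x : ℤ} (h : IsMarkedTransversal N R lo y u X U) (hyu : y ≤ u)
    (hx : x ∈ X) (hy : x < y) (hmax : ∀ z ∈ X, z < y → z ≤ x) :
    IsMarkedTransversal N (R.erase (x : ZMod N)) lo x u (X.erase x) U where
  subset z hz := Finset.mem_erase.mpr ⟨by
    rintro rfl
    rcases h.range z hx with h1 | h1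
    · exact h1.2.2 hz
    · omega, h.subset hz⟩
  injOn := h.injOn.mono (by simp)
  image := h.image_erase hx
  range z hz := by
    obtain ⟨hzx, hz⟩ := Finset.mem_erase.mp hz
    rcases h.range z hz with ⟨h1, h2, h3⟩ | h1
    · exact Or.inl ⟨h1, lt_of_le_of_ne (hmax z hz h2) hzx, h3⟩
    · exact Or.inr h1
  top z hz hzu := h.top z (Finset.mem_of_mem_erase hz) hzu
  chain := h.chain

theorem insert_marked {w : ℤ} (huw : u < w) (hwN : w < u + N)
    (hwR : (w : ZMod N) ∈ R) (h : IsMarkedTransversal N (R.erase (w : ZMod N)) u w w X U) :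
    IsMarkedTransversal N R lo y u (insert w X) (insert w U) where
  subset := Finset.insert_subset_insert _ h.subset
  injOn := h.injOn_insert
  image := h.image_insert hwR
  range z hz := by
    rcases Finset.mem_insert.mp hz with rfl | hz
    · exact Or.inr huw
    · rcases h.range z hz with h1 | h1 <;> exact Or.inr (by omega)
  top z hz hzu := by
    rcases Finset.mem_insert.mp hz with rfl | hz
    · exact ⟨z, Finset.mem_insert_self _ _, le_rfl⟩
    · rcases h.range z hz with h1 | h1
      · exact ⟨w, Finset.mem_insert_self _ _, h1.2.1.le⟩
      · obtain ⟨v, hv, hzv⟩ := h.top z hz h1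
        exact ⟨v, Finset.mem_insert_of_mem hv, hzv⟩
  chain v hv := by
    rcases Finset.mem_insert.mp hv with rfl | hv
    · exact ⟨u, Finset.mem_insert_self _ _, huw, hwN⟩
    · obtain ⟨v', hv', hlt⟩ := h.chain v hv
      exact ⟨v', Finset.mem_insert_of_mem hv', hlt⟩

theorem erase_marked {w : ℤ} (h : IsMarkedTransversal N R lo y u X U)
    (hX : ∀ x ∈ X, u < x) (hw : w ∈ U) (hmin : ∀ v ∈ U, w ≤ v) :
    IsMarkedTransversal N (R.erase (w : ZMod N)) u w w (X.erase w) (U.erase w) where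
  subset := Finset.erase_subset_erase _ h.subset
  injOn := h.injOn.mono (by simp)
  image := h.image_erase (h.subset hw)
  range z hz := by
    obtain ⟨hzw, hz⟩ := Finset.mem_erase.mp hz
    rcases lt_or_gt_of_ne hzw with h1 | h1
    · refine Or.inl ⟨hX z hz, h1, fun hU => ?_⟩
      have := hmin z (Finset.mem_of_mem_erase hU)
      omega
    · exact Or.inr h1
  top z hz hzw := by
    have hz' := Finset.mem_of_mem_erase hz
    obtain ⟨v, hv, hzv⟩ := h.top z hz' (hX z hz')
    exact ⟨v, Finset.mem_erase.mpr ⟨by omega, hv⟩, hzv⟩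
  chain v hv := by
    obtain ⟨hvw, hv⟩ := Finset.mem_erase.mp hv
    have hwv : w < v := lt_of_le_of_ne (hmin v hv) (Ne.symm hvw)
    have huw := hX w (h.subset hw)
    rw [Finset.insert_erase hw]
    obtain ⟨v', hv', hlt⟩ := h.chain v hv
    rcases Finset.mem_insert.mp hv' with rfl | hv'
    · exact ⟨w, hw, hwv, by omega⟩
    · exact ⟨v', hv', hlt⟩

/-- Moving the reference point of the quotients from `u` up to `w` costs one for every residue class
between them. -/
theorem sum_ediv_shift {w : ℤ} (h : IsMarkedTransversal N R lo y w X U) (huR : (u : ZMod N) ∉ R)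
    (huw : u < w) (hwN : w < u + N) :
    ∑ x ∈ X, (x - u) / (N : ℤ) = ∑ x ∈ X, (x - w) / (N : ℤ) +
      ((Finset.Ioo u w).filter fun x : ℤ => (x : ZMod N) ∈ R).card := by
  have hN : (0 : ℤ) < N := by omega
  have h1 : ∀ x : ℤ, (x - u) / (N : ℤ) =
      (x - w) / (N : ℤ) + if (x - u) % (N : ℤ) < w - u then 1 else 0 := by
    intro x
    rw [← Int.ediv_sub_ediv_sub (a := x - u) (d := w - u) (N := N) (by omega) (by omega)]
    rw [show x - u - (w - u) = x - w by ring]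
    ring
  rw [Finset.sum_congr rfl fun x _ => h1 x, Finset.sum_add_distrib, Finset.sum_boole]
  congr 2
  have hcast : ∀ x : ℤ, ((u + (x - u) % (N : ℤ) : ℤ) : ZMod N) = x := by
    intro x
    push_cast
    ring
  refine Finset.card_bij (fun x _ => u + (x - u) % (N : ℤ)) ?_ ?_ ?_
  · intro x hx
    rw [Finset.mem_filter] at hx
    have h0 := Int.emod_nonneg (x - u) hN.ne'
    have hne : (x - u) % (N : ℤ) ≠ 0 := by
      intro h0
      have := hcast x
      rw [h0, add_zero] at this
      exact huR (this ▸ h.cast_mem hx.1)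
    rw [Finset.mem_filter, Finset.mem_Ioo, hcast]
    exact ⟨⟨by omega, by omega⟩, h.cast_mem hx.1⟩
  · intro x hx x' hx' he
    rw [Finset.mem_filter] at hx hx'
    refine h.injOn hx.1 hx'.1 ?_
    simp only
    rw [← hcast x, ← hcast x', he]
  · intro z hz
    rw [Finset.mem_filter, Finset.mem_Ioo, ← h.image, Finset.mem_image] at hz
    obtain ⟨⟨h2, h3⟩, x, hx, hxz⟩ := hz
    have h4 : (x - u) % (N : ℤ) = z - u := by
      have : (((x - u : ℤ)) : ZMod N) = ((z - u : ℤ) : ZMod N) := by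
        push_cast
        rw [hxz]
      have := (ZMod.intCast_eq_intCast_iff _ _ _).mp this
      rw [Int.ModEq] at this
      rw [this, Int.emod_eq_of_lt (by omega) (by omega)]
    refine ⟨x, ?_, by omega⟩
    rw [Finset.mem_filter]
    exact ⟨hx, by omega⟩

end IsMarkedTransversal

theorem card_filter_cast_mem {N : ℕ} {R : Finset (ZMod N)} {u : ℤ} (hN : 0 < N)
    (hu : (u : ZMod N) ∉ R) :
    ((Finset.Ioo u (u + N)).filter fun x : ℤ => (x : ZMod N) ∈ R).card = R.card := by
  have : NeZero N := ⟨hN.ne'⟩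
  refine Finset.card_bij (fun x _ => (x : ZMod N)) ?_ ?_ ?_
  · intro x hx
    exact (Finset.mem_filter.mp hx).2
  · intro x hx x' hx' he
    rw [Finset.mem_filter, Finset.mem_Ioo] at hx hx'
    have h1 := (ZMod.intCast_eq_intCast_iff_dvd_sub _ _ _).mp he
    have h2 := Int.eq_zero_of_abs_lt_dvd h1 (by rw [abs_lt]; constructor <;> omega)
    omega
  · intro r hr
    have hN' : (0 : ℤ) < N := by omega
    have h0 := Int.emod_nonneg ((r.val : ℤ) - u) hN'.ne'
    have h1 := Int.emod_lt_of_pos ((r.val : ℤ) - u) hN'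
    have hcast : ((u + ((r.val : ℤ) - u) % (N : ℤ) : ℤ) : ZMod N) = r := by
      push_cast
      simp
    have hne : ((r.val : ℤ) - u) % (N : ℤ) ≠ 0 := by
      intro h0
      rw [h0, add_zero] at hcast
      exact hu (hcast ▸ hr)
    refine ⟨u + ((r.val : ℤ) - u) % (N : ℤ), ?_, hcast⟩
    rw [Finset.mem_filter, Finset.mem_Ioo, hcast]
    exact ⟨⟨by omega, by omega⟩, hr⟩

open Polynomial in
/-- The weight of a marked transversal: the variable counts unmarked elements, and the exponent of
`q` is the sum of the quotients by `N` relative to `u`. -/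
noncomputable def transversalWeight (N : ℕ) (u : ℤ) (p : Finset ℤ × Finset ℤ) :
    (LaurentPolynomial ℤ)[X] :=
  X ^ (p.1 \ p.2).card * C (LaurentPolynomial.T (∑ x ∈ p.1, (x - u) / (N : ℤ)))

section

variable {N : ℕ} {R : Finset (ZMod N)} {lo y u : ℤ}

theorem transversalWeight_insert_unmarked {x : ℤ} {p : Finset ℤ × Finset ℤ}
    (hlo : u - N ≤ lo) (hx : lo < x) (hxu : x < u)
    (h : IsMarkedTransversal N (R.erase (x : ZMod N)) lo x u p.1 p.2) :
    transversalWeight N u (insert x p.1, p.2) =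
      Polynomial.X * Polynomial.C (LaurentPolynomial.T (-1)) * transversalWeight N u p := by
  have hxX := h.notMem_of_erase
  have hxU : x ∉ p.2 := fun hU => hxX (h.subset hU)
  have hq : (x - u) / (N : ℤ) = -1 :=
    ((Int.ediv_emod_unique (by omega) (r := x - u + N)).mpr ⟨by ring, by omega, by omega⟩).1
  simp only [transversalWeight]
  rw [Finset.insert_sdiff_of_notMem _ hxU,
    Finset.card_insert_of_notMem fun hm => hxX (Finset.mem_sdiff.mp hm).1,
    Finset.sum_insert hxX, hq, LaurentPolynomial.T_add, Polynomial.C_mul]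
  ring

theorem transversalWeight_insert_marked {w : ℤ} {p : Finset ℤ × Finset ℤ}
    (huR : (u : ZMod N) ∉ R) (huw : u < w) (hwN : w < u + N)
    (h : IsMarkedTransversal N (R.erase (w : ZMod N)) u w w p.1 p.2) :
    transversalWeight N u (insert w p.1, insert w p.2) =
      Polynomial.C (LaurentPolynomial.T
        ((((Finset.Ioo u w).filter fun x : ℤ => (x : ZMod N) ∈ R.erase (w : ZMod N)).card : ℕ) :
          ℤ)) * transversalWeight N w p := by
  have hwX := h.notMem_of_erase
  have hq : (w - u) / (N : ℤ) = 0 := Int.ediv_eq_zero_of_lt (by omega) (by omega)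
  have hs : insert w p.1 \ insert w p.2 = p.1 \ p.2 := by
    ext z
    simp only [Finset.mem_sdiff, Finset.mem_insert]
    constructor
    · rintro ⟨h1, h2⟩
      tauto
    · rintro ⟨h1, h2⟩
      refine ⟨Or.inr h1, ?_⟩
      rintro (rfl | h3)
      · exact hwX h1
      · exact h2 h3
  simp only [transversalWeight]
  rw [hs, Finset.sum_insert hwX, hq, zero_add,
    h.sum_ediv_shift (fun hm => huR (Finset.mem_of_mem_erase hm)) huw hwN, LaurentPolynomial.T_add,
    Polynomial.C_mul]
  ring

theorem filter_cast_erase {lo y x : ℤ} (hx : x ≤ y) (hyN : y ≤ lo + N) :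
    ((Finset.Ioo lo x).filter fun z : ℤ => (z : ZMod N) ∈ R.erase (x : ZMod N)) =
      ((Finset.Ioo lo y).filter fun z : ℤ => (z : ZMod N) ∈ R).filter (· < x) := by
  ext z
  simp only [Finset.mem_filter, Finset.mem_Ioo, Finset.mem_erase]
  constructor
  · rintro ⟨⟨h1, h2⟩, h3, h4⟩
    exact ⟨⟨⟨h1, by omega⟩, h4⟩, h2⟩
  · rintro ⟨⟨⟨h1, h2⟩, h3⟩, h4⟩
    refine ⟨⟨h1, h4⟩, fun he => ?_, h3⟩
    have h5 := (ZMod.intCast_eq_intCast_iff_dvd_sub _ _ _).mp he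
    have h6 := Int.eq_zero_of_abs_lt_dvd h5 (by rw [abs_lt]; constructor <;> omega)
    omega

end

/-- Marked transversals are built by adding, one at a time, the largest unmarked element below the
current mark or else the next mark; the weights obey the recursion of `rankPoly`. -/
theorem exists_sum_transversalWeight {N : ℕ} (hN : 0 < N) (r : ℕ) :
    ∀ (R : Finset (ZMod N)) (lo y u : ℤ), R.card = r → (u : ZMod N) ∉ R →
      u - N ≤ lo → lo ≤ y → y ≤ u →
      ∃ F : Finset (Finset ℤ × Finset ℤ),
        (∀ p, p ∈ F ↔ IsMarkedTransversal N R lo y u p.1 p.2) ∧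
        ∑ p ∈ F, transversalWeight N u p =
          rankPoly r ((Finset.Ioo lo y).filter fun x : ℤ => (x : ZMod N) ∈ R).card := by
  classical
  induction r with
  | zero =>
    intro R lo y u hR _ _ _ _
    rw [Finset.card_eq_zero] at hR
    subst hR
    refine ⟨{(∅, ∅)}, fun p => ?_, by simp [transversalWeight, rankPoly]⟩
    rw [Finset.mem_singleton]
    constructor
    · rintro rfl
      exact ⟨by simp, by simp, by simp, by simp, by simp, by simp⟩
    · intro h
      have h1 : p.1 = ∅ := Finset.image_eq_empty.mp h.image
      have h2 : p.2 = ∅ := Finset.subset_empty.mp (h1 ▸ h.subset)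
      exact Prod.ext h1 h2
  | succ r ih =>
    intro R lo y u hR huR hlo hloy hyu
    set A := (Finset.Ioo lo y).filter fun x : ℤ => (x : ZMod N) ∈ R with hA
    set B := (Finset.Ioo u (u + N)).filter fun x : ℤ => (x : ZMod N) ∈ R with hB
    have memA : ∀ {x}, x ∈ A ↔ (lo < x ∧ x < y) ∧ (x : ZMod N) ∈ R := by simp [hA]
    have memB : ∀ {x}, x ∈ B ↔ (u < x ∧ x < u + N) ∧ (x : ZMod N) ∈ R := by simp [hB]
    have hcard : ∀ {x : ℤ}, (x : ZMod N) ∈ R → (R.erase (x : ZMod N)).card = r := by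
      intro x hx
      rw [Finset.card_erase_of_mem hx, hR, Nat.add_sub_cancel]
    have ihA : ∀ x, x ∈ A → ∃ F : Finset (Finset ℤ × Finset ℤ),
        (∀ p, p ∈ F ↔ IsMarkedTransversal N (R.erase (x : ZMod N)) lo x u p.1 p.2) ∧
        ∑ p ∈ F, transversalWeight N u p = rankPoly r (A.filter (· < x)).card := by
      intro x hx
      obtain ⟨⟨h1, h2⟩, h3⟩ := memA.mp hx
      rw [hA, ← filter_cast_erase h2.le (by omega)]
      exact ih _ lo x u (hcard h3) (fun hm => huR (Finset.mem_of_mem_erase hm)) hlo h1.le (by omega)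
    have ihB : ∀ w, w ∈ B → ∃ F : Finset (Finset ℤ × Finset ℤ),
        (∀ p, p ∈ F ↔ IsMarkedTransversal N (R.erase (w : ZMod N)) u w w p.1 p.2) ∧
        ∑ p ∈ F, transversalWeight N w p = rankPoly r (B.filter (· < w)).card := by
      intro w hw
      obtain ⟨⟨h1, h2⟩, h3⟩ := memB.mp hw
      rw [hB, ← filter_cast_erase h2.le le_rfl]
      exact ih _ u w w (hcard h3) (by simp) (by omega) h1.le le_rfl
    choose! FA hFA hFA' using ihA
    choose! FB hFB hFB' using ihB
    let fA : ℤ → Finset ℤ × Finset ℤ → Finset ℤ × Finset ℤ := fun x p => (insert x p.1, p.2)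
    let fB : ℤ → Finset ℤ × Finset ℤ → Finset ℤ × Finset ℤ :=
      fun w p => (insert w p.1, insert w p.2)
    let GA := A.biUnion fun x => (FA x).image (fA x)
    let GB := B.biUnion fun w => (FB w).image (fB w)
    have hdisj : Disjoint GA GB := by
      rw [Finset.disjoint_left]
      intro s hs hs'
      obtain ⟨x, hx, hs⟩ := Finset.mem_biUnion.mp hs
      obtain ⟨p, hp, rfl⟩ := Finset.mem_image.mp hs
      obtain ⟨w, hw, hs'⟩ := Finset.mem_biUnion.mp hs'
      obtain ⟨p', hp', he⟩ := Finset.mem_image.mp hs'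
      have h1 : x ∈ insert w p'.1 := by
        rw [show insert w p'.1 = insert x p.1 from congrArg Prod.fst he]
        exact Finset.mem_insert_self _ _
      obtain ⟨⟨h2, h3⟩, -⟩ := memA.mp hx
      obtain ⟨⟨h4, h5⟩, -⟩ := memB.mp hw
      rcases Finset.mem_insert.mp h1 with rfl | h1
      · omega
      · rcases ((hFB w hw p').mp hp').range x h1 with h6 | h6 <;> omega
    have hdisjA : (A : Set ℤ).PairwiseDisjoint fun x => (FA x).image (fA x) := by
      intro x hx x' hx' hne
      rw [Function.onFun, Finset.disjoint_left]
      intro s hs hs'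
      obtain ⟨p, hp, rfl⟩ := Finset.mem_image.mp hs
      obtain ⟨p', hp', he⟩ := Finset.mem_image.mp hs'
      have he1 : insert x' p'.1 = insert x p.1 := congrArg Prod.fst he
      obtain ⟨⟨-, h3⟩, -⟩ := memA.mp hx
      obtain ⟨⟨-, h3'⟩, -⟩ := memA.mp hx'
      have h1 : x ∈ p'.1 := Finset.mem_of_mem_insert_of_ne
        (he1 ▸ Finset.mem_insert_self _ _) hne
      have h2 : x' ∈ p.1 := Finset.mem_of_mem_insert_of_ne
        (he1 ▸ Finset.mem_insert_self _ _) (Ne.symm hne)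
      rcases ((hFA x' hx' p').mp hp').range x h1 with h6 | h6 <;>
        rcases ((hFA x hx p).mp hp).range x' h2 with h7 | h7 <;> omega
    have hdisjB : (B : Set ℤ).PairwiseDisjoint fun w => (FB w).image (fB w) := by
      intro w hw w' hw' hne
      rw [Function.onFun, Finset.disjoint_left]
      intro s hs hs'
      obtain ⟨p, hp, rfl⟩ := Finset.mem_image.mp hs
      obtain ⟨p', hp', he⟩ := Finset.mem_image.mp hs'
      have he2 : insert w' p'.2 = insert w p.2 := congrArg Prod.snd he
      have h1 : w ∈ p'.2 := Finset.mem_of_mem_insert_of_ne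
        (he2 ▸ Finset.mem_insert_self _ _) hne
      have h2 : w' ∈ p.2 := Finset.mem_of_mem_insert_of_ne
        (he2 ▸ Finset.mem_insert_self _ _) (Ne.symm hne)
      have h3 := (hFB w' hw' p').mp hp'
      have h4 := (hFB w hw p).mp hp
      rcases h3.range w (h3.subset h1) with h6 | h6
      · exact h6.2.2 h1
      · rcases h4.range w' (h4.subset h2) with h7 | h7
        · exact h7.2.2 h2
        · omega
    refine ⟨GA ∪ GB, fun s => ?_, ?_⟩
    · rw [Finset.mem_union]
      constructor
      · rintro (hs | hs)
        · obtain ⟨x, hx, hs⟩ := Finset.mem_biUnion.mp hs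
          obtain ⟨p, hp, rfl⟩ := Finset.mem_image.mp hs
          obtain ⟨⟨h2, h3⟩, h4⟩ := memA.mp hx
          exact ((hFA x hx p).mp hp).insert_unmarked h2 h3 hyu h4
        · obtain ⟨w, hw, hs⟩ := Finset.mem_biUnion.mp hs
          obtain ⟨p, hp, rfl⟩ := Finset.mem_image.mp hs
          obtain ⟨⟨h2, h3⟩, h4⟩ := memB.mp hw
          exact ((hFB w hw p).mp hp).insert_marked h2 h3 h4
      · intro h
        by_cases hne : (s.1.filter (· < y)).Nonempty
        · left
          obtain ⟨hx1, hx2⟩ := Finset.mem_filter.mp (Finset.max'_mem _ hne)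
          set x := (s.1.filter (· < y)).max' hne
          have hxA : x ∈ A := by
            refine memA.mpr ⟨⟨?_, hx2⟩, h.cast_mem hx1⟩
            rcases h.range x hx1 with h1 | h1 <;> omega
          refine Finset.mem_biUnion.mpr ⟨x, hxA, Finset.mem_image.mpr ⟨(s.1.erase x, s.2), ?_, ?_⟩⟩
          · exact (hFA x hxA _).mpr (h.erase_unmarked hyu hx1 hx2 fun z hz hzy =>
              Finset.le_max' _ _ (Finset.mem_filter.mpr ⟨hz, hzy⟩))
          · exact Prod.ext (Finset.insert_erase hx1) rfl
        · right
          rw [Finset.not_nonempty_iff_eq_empty, Finset.filter_eq_empty_iff] at hne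
          have hX : ∀ x ∈ s.1, u < x := by
            intro x hx
            have := hne hx
            rcases h.range x hx with h1 | h1 <;> omega
          have hR' : R.Nonempty := Finset.card_pos.mp (by omega)
          rw [← h.image, Finset.image_nonempty] at hR'
          obtain ⟨x, hx⟩ := hR'
          obtain ⟨v, hv, -⟩ := h.top x hx (hX x hx)
          have hU : s.2.Nonempty := ⟨v, hv⟩
          have hw := s.2.min'_mem hU
          set w := s.2.min' hU
          have hmin : ∀ v ∈ s.2, w ≤ v := fun v hv => s.2.min'_le v hv
          have hwB : w ∈ B := by
            refine memB.mpr ⟨⟨hX w (h.subset hw), ?_⟩, h.cast_mem (h.subset hw)⟩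
            obtain ⟨w', hw', hlt, hlt'⟩ := h.chain w hw
            rcases Finset.mem_insert.mp hw' with rfl | hw'
            · exact hlt'
            · exact absurd (hmin w' hw') (not_le.mpr hlt)
          refine Finset.mem_biUnion.mpr
            ⟨w, hwB, Finset.mem_image.mpr ⟨(s.1.erase w, s.2.erase w), ?_, ?_⟩⟩
          · exact (hFB w hwB _).mpr (h.erase_marked hX hw hmin)
          · exact Prod.ext (Finset.insert_erase (h.subset hw)) (Finset.insert_erase hw)
    · rw [Finset.sum_union hdisj, Finset.sum_biUnion hdisjA, Finset.sum_biUnion hdisjB, add_comm,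
        rankPoly]
      have hBcard : B.card = r + 1 := by rw [hB, card_filter_cast_mem hN huR, hR]
      congr 1
      · rw [← hBcard, ← Finset.sum_card_filter_lt B
          fun i => Polynomial.C (LaurentPolynomial.T (i : ℤ)) * rankPoly r i]
        refine Finset.sum_congr rfl fun w hw => ?_
        obtain ⟨⟨h2, h3⟩, h4⟩ := memB.mp hw
        rw [Finset.sum_image, ← hFB' w hw, Finset.mul_sum]
        · refine Finset.sum_congr rfl fun p hp => ?_
          simp only [fB]
          rw [transversalWeight_insert_marked huR h2 h3 ((hFB w hw p).mp hp),
            filter_cast_erase h3.le le_rfl]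
        · intro p hp p' hp' he
          have h5 := ((hFB w hw p).mp hp)
          have h6 := ((hFB w hw p').mp hp')
          have h7 := h5.notMem_of_erase
          have h8 := h6.notMem_of_erase
          refine Prod.ext ?_ ?_
          · rw [← Finset.erase_insert h7, ← Finset.erase_insert h8]
            exact congrArg (fun q => q.1.erase w) he
          · rw [← Finset.erase_insert fun hm => h7 (h5.subset hm),
              ← Finset.erase_insert fun hm => h8 (h6.subset hm)]
            exact congrArg (fun q => q.2.erase w) he
      · rw [← Finset.sum_card_filter_lt A fun i =>
          Polynomial.X * Polynomial.C (LaurentPolynomial.T (-1)) * rankPoly r i]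
        refine Finset.sum_congr rfl fun x hx => ?_
        obtain ⟨⟨h2, h3⟩, h4⟩ := memA.mp hx
        rw [Finset.sum_image, ← hFA' x hx, Finset.mul_sum]
        · refine Finset.sum_congr rfl fun p hp => ?_
          exact transversalWeight_insert_unmarked hlo h2 (by omega) ((hFA x hx p).mp hp)
        · intro p hp p' hp' he
          have h7 := ((hFA x hx p).mp hp).notMem_of_erase
          have h8 := ((hFA x hx p').mp hp').notMem_of_erase
          refine Prod.ext ?_ (congrArg (fun q => q.2) he)
          rw [← Finset.erase_insert h7, ← Finset.erase_insert h8]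
          exact congrArg (fun q => q.1.erase x) he

/-! ### The generating polynomial of words -/

section Words

variable {α : Type*} [LinearOrder α]

/-- The number of later, larger letters. -/
def laterLarger {r : ℕ} (g : Fin r → α) (i : Fin r) : ℕ :=
  (Finset.univ.filter fun j : Fin r => i < j ∧ g i < g j).card

open Polynomial in
/-- The factor of the letter `i` in the weight of the word `g` preceded by the letter `p`. -/
noncomputable def letterFactor {r : ℕ} (p : α) (g : Fin r → α) (i : Fin r) :
    (LaurentPolynomial ℤ)[X] :=
  C (LaurentPolynomial.T (laterLarger g i : ℤ)) *
    if (Fin.cons p g : Fin (r + 1) → α) i.castSucc < g i then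
      1 + X * C (LaurentPolynomial.T (-((laterLarger g i : ℤ) + 1))) else 1

theorem C_T_mul_ite (a : ℤ) (p : Prop) [Decidable p] :
    (Polynomial.C (LaurentPolynomial.T a) *
      if p then 1 + Polynomial.X * Polynomial.C (LaurentPolynomial.T (-(a + 1))) else 1 :
        Polynomial (LaurentPolynomial ℤ)) =
      Polynomial.C (LaurentPolynomial.T a) +
        if p then Polynomial.X * Polynomial.C (LaurentPolynomial.T (-1)) else 0 := by
  split_ifs
  · rw [mul_add, mul_one, mul_left_comm, ← Polynomial.C_mul, ← LaurentPolynomial.T_add,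
      show a + -(a + 1) = -1 by ring]
  · rw [mul_one, add_zero]

theorem laterLarger_cons_succ {r : ℕ} (x : α) (g : Fin r → α) (i : Fin r) :
    laterLarger (Fin.cons x g : Fin (r + 1) → α) i.succ = laterLarger g i := by
  simp only [laterLarger, Finset.card_filter]
  rw [Fin.sum_univ_succ]
  simp

theorem letterFactor_cons_succ {r : ℕ} (p x : α) (g : Fin r → α) (i : Fin r) :
    letterFactor p (Fin.cons x g : Fin (r + 1) → α) i.succ = letterFactor x g i := by
  simp only [letterFactor, laterLarger_cons_succ, Fin.cons_succ]
  rw [Fin.castSucc_succ, Fin.cons_succ]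

theorem laterLarger_cons_zero {r : ℕ} {x : α} {g : Fin r → α} (hg : Function.Injective g)
    {R : Finset α} (hR : Finset.univ.image g = R.erase x) :
    laterLarger (Fin.cons x g : Fin (r + 1) → α) 0 = (R.filter (x < ·)).card := by
  have h1 : R.filter (x < ·) = (Finset.univ.image g).filter (x < ·) := by
    rw [hR]
    ext z
    simp only [Finset.mem_filter, Finset.mem_erase]
    exact ⟨fun ⟨h, h'⟩ => ⟨⟨h'.ne', h⟩, h'⟩, fun ⟨⟨_, h⟩, h'⟩ => ⟨h, h'⟩⟩
  rw [h1, Finset.filter_image, Finset.card_image_of_injective _ hg]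
  simp only [laterLarger, Finset.card_filter]
  rw [Fin.sum_univ_succ]
  simp

/-- Removing the first letter of a word gives the recursion of `rankPoly`. -/
theorem exists_sum_prod_letterFactor (r : ℕ) : ∀ (R : Finset α) (p : α), R.card = r → p ∉ R →
    ∃ F : Finset (Fin r → α),
      (∀ g, g ∈ F ↔ Function.Injective g ∧ Finset.univ.image g = R) ∧
      ∑ g ∈ F, ∏ i, letterFactor p g i = rankPoly r (R.filter (p < ·)).card := by
  classical
  induction r with
  | zero =>
    intro R p hR _
    rw [Finset.card_eq_zero] at hR
    subst hR
    refine ⟨{Fin.elim0}, fun g => ?_, by simp [rankPoly]⟩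
    rw [Finset.mem_singleton]
    exact ⟨fun _ => ⟨fun i => i.elim0, by simp⟩, fun _ => Subsingleton.elim _ _⟩
  | succ r ih =>
    intro R p hR hp
    have ihR : ∀ x, x ∈ R → ∃ F : Finset (Fin r → α),
        (∀ g, g ∈ F ↔ Function.Injective g ∧ Finset.univ.image g = R.erase x) ∧
        ∑ g ∈ F, ∏ i, letterFactor x g i = rankPoly r (R.filter (x < ·)).card := by
      intro x hx
      have h1 : (R.erase x).filter (x < ·) = R.filter (x < ·) := by
        ext z
        simp only [Finset.mem_filter, Finset.mem_erase]
        exact ⟨fun ⟨⟨_, h⟩, h'⟩ => ⟨h, h'⟩, fun ⟨h, h'⟩ => ⟨⟨h'.ne', h⟩, h'⟩⟩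
      rw [← h1]
      exact ih _ x (by rw [Finset.card_erase_of_mem hx, hR, Nat.add_sub_cancel]) (by simp)
    choose! F hF hF' using ihR
    let f : α → (Fin r → α) → Fin (r + 1) → α := fun x g => Fin.cons x g
    have hdisj : (R : Set α).PairwiseDisjoint fun x => (F x).image (f x) := by
      intro x _ x' _ hne
      rw [Function.onFun, Finset.disjoint_left]
      intro s hs hs'
      obtain ⟨g, -, rfl⟩ := Finset.mem_image.mp hs
      obtain ⟨g', -, he⟩ := Finset.mem_image.mp hs'
      exact hne (Fin.cons_inj.mp he).1.symm
    refine ⟨R.biUnion fun x => (F x).image (f x), fun s => ?_, ?_⟩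
    · rw [Finset.mem_biUnion]
      constructor
      · rintro ⟨x, hx, hs⟩
        obtain ⟨g, hg, rfl⟩ := Finset.mem_image.mp hs
        obtain ⟨hinj, himg⟩ := (hF x hx g).mp hg
        constructor
        · rw [Fin.cons_injective_iff]
          refine ⟨?_, hinj⟩
          rintro ⟨i, hi⟩
          have : x ∈ R.erase x := himg ▸ Finset.mem_image.mpr ⟨i, Finset.mem_univ i, hi⟩
          simp at this
        · rw [← Finset.insert_erase hx, ← himg]
          ext z
          simp only [f, Finset.mem_image, Finset.mem_univ, true_and, Finset.mem_insert,
            Fin.exists_fin_succ, Fin.cons_zero, Fin.cons_succ, eq_comm]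
      · rintro ⟨hinj, himg⟩
        have hx : s 0 ∈ R := himg ▸ Finset.mem_image_of_mem _ (Finset.mem_univ _)
        refine ⟨s 0, hx, Finset.mem_image.mpr ⟨Fin.tail s, (hF _ hx _).mpr ⟨?_, ?_⟩,
          Fin.cons_self_tail s⟩⟩
        · exact hinj.comp (Fin.succ_injective r)
        · ext z
          rw [Finset.mem_erase, ← himg]
          simp only [Finset.mem_image, Finset.mem_univ, true_and, Fin.exists_fin_succ, Fin.tail]
          constructor
          · rintro ⟨i, rfl⟩
            exact ⟨fun he => Fin.succ_ne_zero i (hinj he), Or.inr ⟨i, rfl⟩⟩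
          · rintro ⟨hz, h | h⟩
            · exact absurd h.symm hz
            · exact h
    · rw [Finset.sum_biUnion hdisj, rankPoly]
      -- The letter `x` exceeds the preceding letter `p` if and only if its rank is below the bound.
      have hlt : ∀ x ∈ R, (p < x ↔ (R.filter (x < ·)).card < (R.filter (p < ·)).card) := by
        intro x hx
        constructor
        · intro hpx
          refine Finset.card_lt_card (Finset.ssubset_iff_subset_ne.mpr ⟨?_, fun he => ?_⟩)
          · intro z hz
            rw [Finset.mem_filter] at hz ⊢
            exact ⟨hz.1, hpx.trans hz.2⟩
          · have : x ∈ R.filter (x < ·) := he ▸ Finset.mem_filter.mpr ⟨hx, hpx⟩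
            simp at this
        · intro hc
          by_contra! hxp
          refine absurd (Finset.card_le_card fun z hz => ?_) (not_le.mpr hc)
          rw [Finset.mem_filter] at hz ⊢
          exact ⟨hz.1, hxp.trans_lt hz.2⟩
      have hj : (R.filter (p < ·)).card ≤ r + 1 := hR ▸ Finset.card_filter_le _ _
      have hrange : ∑ i ∈ Finset.range (R.filter (p < ·)).card,
          Polynomial.X * Polynomial.C (LaurentPolynomial.T (-1)) * rankPoly r i =
          ∑ i ∈ Finset.range (r + 1), if i < (R.filter (p < ·)).card then
            Polynomial.X * Polynomial.C (LaurentPolynomial.T (-1)) * rankPoly r i else 0 := by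
        rw [← Finset.sum_filter]
        refine Finset.sum_congr ?_ fun _ _ => rfl
        ext i
        simp only [Finset.mem_filter, Finset.mem_range]
        omega
      rw [hrange, ← Finset.sum_add_distrib]
      refine Eq.trans ?_ ((Finset.sum_card_filter_gt R fun i =>
        Polynomial.C (LaurentPolynomial.T (i : ℤ)) * rankPoly r i +
          if i < (R.filter (p < ·)).card then
            Polynomial.X * Polynomial.C (LaurentPolynomial.T (-1)) * rankPoly r i else 0).trans
        (by rw [hR]))
      refine Finset.sum_congr rfl fun x hx => ?_
      rw [Finset.sum_image fun g _ g' _ he => (Fin.cons_inj.mp he).2, ← hF' x hx]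
      have hterm : ∀ g ∈ F x, ∏ i, letterFactor p (f x g) i =
          (Polynomial.C (LaurentPolynomial.T ((R.filter (x < ·)).card : ℤ)) +
            if (R.filter (x < ·)).card < (R.filter (p < ·)).card then
              Polynomial.X * Polynomial.C (LaurentPolynomial.T (-1)) else 0) *
            ∏ i, letterFactor x g i := by
        intro g hg
        obtain ⟨hinj, himg⟩ := (hF x hx g).mp hg
        rw [Fin.prod_univ_succ]
        refine congrArg₂ (· * ·) ?_ ?_
        · simp only [letterFactor, f, laterLarger_cons_zero hinj himg, Fin.castSucc_zero,
            Fin.cons_zero, hlt x hx]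
          exact C_T_mul_ite _ _
        · exact Finset.prod_congr rfl fun i _ => letterFactor_cons_succ p x g i
      rw [Finset.sum_congr rfl hterm, ← Finset.mul_sum, add_mul, ite_mul, zero_mul]

end Words

/-! ### Paths with labels `1, …, n` -/

/-- The exponent vector of `x_1 ⋯ x_n`. -/
noncomputable def standardWeight (n : ℕ) : ℕ+ →₀ ℕ :=
  ∑ j : Fin n, Finsupp.single (Nat.succPNat j) 1

theorem succPNat_val_injective (n : ℕ) : Function.Injective fun j : Fin n => Nat.succPNat j :=
  Nat.succPNat_injective.comp Fin.val_injective

namespace LabelledDyckPath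

variable {n : ℕ}

theorem weight_eq_standardWeight_iff (P : LabelledDyckPath n) :
    P.weight = standardWeight n ↔
      Function.Injective P.label ∧ ∀ i, (P.label i : ℕ) ≤ n := by
  classical
  constructor
  · intro h
    have hx : ∀ x, (Finset.univ.filter fun i => P.label i = x).card =
        (Finset.univ.filter fun j : Fin n => Nat.succPNat j = x).card := by
      intro x
      have := DFunLike.congr_fun h x
      simpa [weight, standardWeight, Finsupp.finsetSum_apply, Finsupp.single_apply] using this
    constructor
    · intro i i' he
      have h1 : (Finset.univ.filter fun j : Fin n => Nat.succPNat j = P.label i).card ≤ 1 :=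
        Finset.card_le_one.mpr fun a ha b hb => succPNat_val_injective n
          ((Finset.mem_filter.mp ha).2.trans (Finset.mem_filter.mp hb).2.symm)
      rw [← hx] at h1
      exact Finset.card_le_one.mp h1 i (by simp) i' (by simp [he])
    · intro i
      have h1 : 0 < (Finset.univ.filter fun i' => P.label i' = P.label i).card :=
        Finset.card_pos.mpr ⟨i, by simp⟩
      rw [hx] at h1
      obtain ⟨j, hj⟩ := Finset.card_pos.mp h1
      rw [← (Finset.mem_filter.mp hj).2, Nat.succPNat_coe]
      exact j.isLt
  · rintro ⟨hinj, hle⟩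
    have hpos : ∀ i, 0 < (P.label i : ℕ) := fun i => (P.label i).pos
    let σ : Fin n → Fin n := fun i => ⟨P.label i - 1, by have := hle i; have := hpos i; omega⟩
    have hσ : ∀ i, Nat.succPNat (σ i) = P.label i := by
      intro i
      apply PNat.eq
      rw [Nat.succPNat_coe]
      have := hpos i
      simp only [σ]
      omega
    have hbij : Function.Bijective σ := Finite.injective_iff_bijective.mp fun i j he =>
      hinj (by rw [← hσ i, ← hσ j, he])
    rw [weight, standardWeight]
    exact (Finset.sum_congr rfl fun i _ => by rw [hσ]).trans
      (hbij.sum_comp fun j : Fin n => Finsupp.single (Nat.succPNat j) 1)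

theorem label_lt_of_weight {P : LabelledDyckPath n} (h : P.weight = standardWeight n) (i : Fin n) :
    ((P.label i : ℕ) : ℤ) < ((n + 1 : ℕ) : ℤ) := by
  have := (P.weight_eq_standardWeight_iff.mp h).2 i
  omega

/-- The polynomial `zTerm P` at `t = 1`, with integer coefficients. -/
noncomputable def qzTerm (P : LabelledDyckPath n) : Polynomial (LaurentPolynomial ℤ) :=
  Polynomial.C (LaurentPolynomial.T (P.dinv : ℤ)) *
    ∏ i ∈ P.valleys, (1 + Polynomial.X * Polynomial.C
      (LaurentPolynomial.T (-((P.d i : ℤ) + 1)) : LaurentPolynomial ℤ))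

theorem qzTerm_eq_prod_letterFactor {P : LabelledDyckPath n} (harea : ∀ i, P.area i = 0) {p : ℕ+}
    (hp : ∀ i, P.label i < p) : P.qzTerm = ∏ i, letterFactor p P.label i := by
  classical
  have hd : ∀ i, laterLarger P.label i = P.d i := by
    intro i
    simp [laterLarger, d, harea]
  have hval : ∀ i, (Fin.cons p P.label : Fin (n + 1) → ℕ+) i.castSucc < P.label i ↔
      i ∈ P.valleys := by
    intro i
    simp only [valleys, Finset.mem_filter, Finset.mem_univ, true_and, harea, lt_irrefl, false_or]
    obtain ⟨i, hi⟩ := i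
    cases i with
    | zero =>
      constructor
      · intro h
        exact absurd h (not_lt.mpr (hp _).le)
      · rintro ⟨j, hj, -⟩
        simp at hj
    | succ m =>
      have he : (Fin.cons p P.label : Fin (n + 1) → ℕ+) (⟨m + 1, hi⟩ : Fin n).castSucc =
          P.label ⟨m, by omega⟩ := Fin.cons_succ (α := fun _ => ℕ+) p P.label ⟨m, by omega⟩
      rw [he]
      constructor
      · intro h
        exact ⟨⟨m, by omega⟩, rfl, h⟩
      · rintro ⟨j, hj, h⟩
        have : j = ⟨m, by omega⟩ := Fin.ext (by simp only at hj ⊢; omega)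
        rwa [this] at h
  simp only [letterFactor, hd, hval, Finset.prod_mul_distrib]
  rw [qzTerm]
  congr 1
  · rw [← map_prod]
    congr 1
    simp only [dinv, Nat.cast_sum]
    induction (Finset.univ : Finset (Fin n)) using Finset.induction_on with
    | empty => simp
    | insert a s ha ih =>
      rw [Finset.sum_insert ha, Finset.prod_insert ha, LaurentPolynomial.T_add, ih]
  · rw [Finset.prod_ite_mem, Finset.univ_inter]

theorem totalArea_eq_zero_iff (P : LabelledDyckPath n) : P.totalArea = 0 ↔ ∀ i, P.area i = 0 := by
  simp [totalArea]

open Classical in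
/-- At `t = 0`, the paths with labels `1, …, n` are the permutations. -/
theorem sum_qzTerm_area_zero (n : ℕ) :
    ∑ P ∈ (finite_weight n (standardWeight n)).toFinset.filter (fun P => P.totalArea = 0),
      P.qzTerm = rankPoly n 0 := by
  let R : Finset ℕ+ := Finset.univ.image fun j : Fin n => Nat.succPNat j
  have hR : R.card = n := by
    rw [Finset.card_image_of_injective _ (succPNat_val_injective n), Finset.card_univ,
      Fintype.card_fin]
  have hmem : ∀ {x}, x ∈ R ↔ (x : ℕ) ≤ n := by
    intro x
    simp only [R, Finset.mem_image, Finset.mem_univ, true_and]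
    constructor
    · rintro ⟨j, rfl⟩
      rw [Nat.succPNat_coe]
      exact j.isLt
    · intro hx
      have h0 : 0 < (x : ℕ) := x.pos
      refine ⟨⟨x - 1, by omega⟩, PNat.eq ?_⟩
      rw [Nat.succPNat_coe]
      simp only
      omega
  have hp : Nat.succPNat n ∉ R := by simp [hmem]
  obtain ⟨F, hF, hsum⟩ := exists_sum_prod_letterFactor n R (Nat.succPNat n) hR hp
  have hfilter : R.filter (Nat.succPNat n < ·) = ∅ := by
    rw [Finset.filter_eq_empty_iff]
    intro x hx hlt
    rw [hmem] at hx
    rw [← PNat.coe_lt_coe, Nat.succPNat_coe] at hlt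
    omega
  rw [hfilter, Finset.card_empty] at hsum
  rw [← hsum]
  refine Finset.sum_bij (fun P _ => P.label) ?_ ?_ ?_ ?_
  · intro P hP
    simp only [Finset.mem_filter, Set.Finite.mem_toFinset, Set.mem_ofPred_eq] at hP
    obtain ⟨hinj, hle⟩ := P.weight_eq_standardWeight_iff.mp hP.1
    refine (hF _).mpr ⟨hinj, Finset.eq_of_subset_of_card_le ?_ ?_⟩
    · intro x hx
      obtain ⟨i, -, rfl⟩ := Finset.mem_image.mp hx
      exact hmem.mpr (hle i)
    · rw [hR, Finset.card_image_of_injective _ hinj, Finset.card_univ, Fintype.card_fin]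
  · intro P hP P' hP' he
    rw [Finset.mem_filter, totalArea_eq_zero_iff] at hP hP'
    exact LabelledDyckPath.ext (funext fun i => (hP.2 i).trans (hP'.2 i).symm) he
  · intro g hg
    obtain ⟨hinj, himg⟩ := (hF g).mp hg
    refine ⟨⟨fun _ => 0, g, fun _ _ => rfl, fun _ _ _ => Nat.zero_le _,
      fun _ _ _ h => absurd h (by simp)⟩, ?_, rfl⟩
    rw [Finset.mem_filter, Set.Finite.mem_toFinset, Set.mem_ofPred_eq,
      weight_eq_standardWeight_iff, totalArea_eq_zero_iff]
    exact ⟨⟨hinj, fun i => hmem.mp (himg ▸ Finset.mem_image_of_mem _ (Finset.mem_univ _))⟩,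
      fun _ => rfl⟩
  · intro P hP
    simp only [Finset.mem_filter, Set.Finite.mem_toFinset, Set.mem_ofPred_eq] at hP
    refine qzTerm_eq_prod_letterFactor (P.totalArea_eq_zero_iff.mp hP.2) fun i => ?_
    rw [← PNat.coe_lt_coe, Nat.succPNat_coe]
    exact Nat.lt_succ_of_le ((P.weight_eq_standardWeight_iff.mp hP.1).2 i)

theorem height_ediv (N : ℤ) {P : LabelledDyckPath n} {i : Fin n}
    (h : ((P.label i : ℕ) : ℤ) < N) : P.height N i / N = P.area i ∧
      P.height N i % N = N - (P.label i : ℕ) := by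
  have h0 : 0 < (P.label i : ℕ) := (P.label i).pos
  exact (Int.ediv_emod_unique (by omega)).mpr
    ⟨by simp only [height]; ring, by omega, by omega⟩

/-- Heights which are distinct and nonzero modulo `n + 1` are those of a path with labels
`1, …, n`. -/
theorem exists_height_eq {c : Fin n → ℤ} (h : IsHeightSeq ((n + 1 : ℕ) : ℤ) c)
    (hinj : Function.Injective fun i => (c i : ZMod (n + 1)))
    (h0 : ∀ i, (c i : ZMod (n + 1)) ≠ 0) :
    ∃ P : LabelledDyckPath n, P.weight = standardWeight n ∧
      P.height ((n + 1 : ℕ) : ℤ) = c := by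
  obtain ⟨N, hN⟩ : ∃ N : ℤ, N = ((n + 1 : ℕ) : ℤ) := ⟨_, rfl⟩
  rw [← hN] at h ⊢
  have hN0 : 0 < N := by omega
  have hm1 : ∀ i, 0 < c i % N := by
    intro i
    refine lt_of_le_of_ne (Int.emod_nonneg _ hN0.ne') fun he => h0 i ?_
    rw [ZMod.intCast_zmod_eq_zero_iff_dvd, ← hN]
    exact Int.dvd_of_emod_eq_zero he.symm
  have hm2 : ∀ i, c i % N < N := fun i => Int.emod_lt_of_pos _ hN0
  have hdiv : ∀ i, N * (c i / N) + c i % N = c i := fun i => Int.mul_ediv_add_emod _ _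
  have hd0 : ∀ i, 0 ≤ c i / N := fun i => Int.ediv_nonneg (h.pos i).le hN0.le
  let P : LabelledDyckPath n :=
    { area := fun i => (c i / N).toNat
      label := fun i => ⟨(N - c i % N).toNat, by have := hm2 i; omega⟩
      area_zero := by
        intro i hi
        rw [Int.ediv_eq_zero_of_lt (h.pos i).le (h.first i hi)]
        rfl
      area_step := by
        intro i j hij
        have h1 := h.step i j hij
        have := hd0 i
        have h3 : c j / N ≤ c i / N + 1 := by
          by_contra! hlt
          nlinarith [hdiv i, hdiv j, hm1 j, hm2 i]
        omega
      label_lt := by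
        intro i j hij he
        have h1 := h.step i j hij
        have h2 := hd0 i
        have h3 := hd0 j
        have h4 : c j / N = c i / N + 1 := by omega
        have h5 : c j % N < c i % N := by
          have := hdiv i
          have := hdiv j
          rw [h4] at this
          linarith
        have := hm2 i
        exact Subtype.mk_lt_mk.mpr (by omega) }
  have hl : ∀ i, ((P.label i : ℕ) : ℤ) = N - c i % N := by
    intro i
    have := hm2 i
    simp only [P, PNat.mk_coe]
    omega
  refine ⟨P, P.weight_eq_standardWeight_iff.mpr ⟨fun i j he => hinj ?_, fun i => ?_⟩, ?_⟩
  · have h1 : c i % N = c j % N := by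
      have h2 := hl i
      have h3 := hl j
      rw [he] at h2
      omega
    exact (ZMod.intCast_eq_intCast_iff _ _ _).mpr (hN ▸ h1)
  · have := hl i
    have := hm1 i
    omega
  · funext i
    have h1 : ((P.area i : ℕ) : ℤ) = c i / N := Int.toNat_of_nonneg (hd0 i)
    rw [height, hl, h1]
    linarith [hdiv i]

theorem cast_height_injective {P : LabelledDyckPath n} (h : P.weight = standardWeight n) :
    Function.Injective fun i => (P.height ((n + 1 : ℕ) : ℤ) i : ZMod (n + 1)) := by
  intro i j he
  have h1 := (ZMod.intCast_eq_intCast_iff _ _ _).mp he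
  rw [Int.ModEq, (height_ediv _ (label_lt_of_weight h i)).2,
    (height_ediv _ (label_lt_of_weight h j)).2] at h1
  exact (P.weight_eq_standardWeight_iff.mp h).1 (PNat.eq (by omega))

theorem cast_height_ne_zero {P : LabelledDyckPath n} (h : P.weight = standardWeight n)
    (i : Fin n) : (P.height ((n + 1 : ℕ) : ℤ) i : ZMod (n + 1)) ≠ 0 := by
  intro he
  rw [ZMod.intCast_zmod_eq_zero_iff_dvd] at he
  have h1 := Int.emod_eq_zero_of_dvd he
  rw [(height_ediv _ (label_lt_of_weight h i)).2] at h1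
  have := label_lt_of_weight h i
  omega

theorem image_eq_univ_erase_zero {f : Fin n → ZMod (n + 1)} (hf : Function.Injective f)
    (h0 : ∀ i, f i ≠ 0) : Finset.univ.image f = Finset.univ.erase 0 := by
  refine Finset.eq_of_subset_of_card_le ?_ ?_
  · intro x hx
    obtain ⟨i, -, rfl⟩ := Finset.mem_image.mp hx
    simpa using h0 i
  · rw [Finset.card_erase_of_mem (Finset.mem_univ _), Finset.card_univ, ZMod.card,
      Finset.card_image_of_injective _ hf, Finset.card_univ, Fintype.card_fin, Nat.add_sub_cancel]

open Classical in
/-- At `q = 0`, the paths with labels `1, …, n` are the marked transversals of the nonzero residue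
classes modulo `n + 1`. -/
theorem sum_tight (n : ℕ) :
    ∑ P ∈ (finite_weight n (standardWeight n)).toFinset.filter
        (fun P => IsTight ((n + 1 : ℕ) : ℤ) (P.height ((n + 1 : ℕ) : ℤ))),
      (Polynomial.X : Polynomial (LaurentPolynomial ℤ)) ^ P.valleys.card *
        Polynomial.C (LaurentPolynomial.T (P.totalArea : ℤ)) = rankPoly n 0 := by
  obtain ⟨F, hF, hsum⟩ := exists_sum_transversalWeight (N := n + 1) (Nat.succ_pos n) n
    (Finset.univ.erase 0) 0 0 0
    (by rw [Finset.card_erase_of_mem (Finset.mem_univ _), Finset.card_univ, ZMod.card,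
      Nat.add_sub_cancel]) (by simp) (by omega) le_rfl le_rfl
  rw [Finset.Ioo_self, Finset.filter_empty, Finset.card_empty] at hsum
  rw [← hsum]
  have hseq : ∀ {P : LabelledDyckPath n}, P.weight = standardWeight n →
      IsHeightSeq ((n + 1 : ℕ) : ℤ) (P.height ((n + 1 : ℕ) : ℤ)) := fun h =>
    isHeightSeq_height _ (label_lt_of_weight h)
  have hinj : ∀ {P : LabelledDyckPath n}, P.weight = standardWeight n →
      Function.Injective (P.height ((n + 1 : ℕ) : ℤ)) := fun h =>
    Function.Injective.of_comp (f := fun x : ℤ => (x : ZMod (n + 1))) (cast_height_injective h)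
  refine Finset.sum_bij (fun P _ => (heightSet (P.height ((n + 1 : ℕ) : ℤ)),
    markedHeights (P.height ((n + 1 : ℕ) : ℤ)))) ?_ ?_ ?_ ?_
  · intro P hP
    rw [Finset.mem_filter, Set.Finite.mem_toFinset, Set.mem_ofPred_eq] at hP
    have := hP.2.isMarkedTransversal (hseq hP.1) (cast_height_injective hP.1)
    rw [image_eq_univ_erase_zero (cast_height_injective hP.1) (cast_height_ne_zero hP.1)] at this
    exact (hF _).mpr this
  · intro P hP P' hP' he
    rw [Finset.mem_filter, Set.Finite.mem_toFinset, Set.mem_ofPred_eq] at hP hP'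
    have hh := hP.2.ext (hseq hP.1) (hinj hP.1) (hseq hP'.1) hP'.2 (hinj hP'.1)
      (congrArg Prod.fst he) (congrArg Prod.snd he)
    refine LabelledDyckPath.ext (funext fun i => ?_) (funext fun i => PNat.eq ?_)
    · have h1 := (height_ediv _ (label_lt_of_weight hP.1 i)).1
      have h2 := (height_ediv _ (label_lt_of_weight hP'.1 i)).1
      rw [hh] at h1
      omega
    · have h1 := (height_ediv _ (label_lt_of_weight hP.1 i)).2
      have h2 := (height_ediv _ (label_lt_of_weight hP'.1 i)).2
      rw [hh] at h1
      omega
  · intro p hp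
    have h := (hF p).mp hp
    have hcard : p.1.card = n := by
      rw [← Finset.card_image_of_injOn h.injOn, h.image,
        Finset.card_erase_of_mem (Finset.mem_univ _), Finset.card_univ, ZMod.card,
        Nat.add_sub_cancel]
    obtain ⟨c, hc, ht, hX, hU⟩ := h.exists_isTight hcard
    have hcX : ∀ i, c i ∈ p.1 := fun i => hX ▸ mem_heightSet.mpr ⟨i, rfl⟩
    have hcinj : Function.Injective c := by
      have : (Finset.univ.image c).card = (Finset.univ : Finset (Fin n)).card := by
        rw [Finset.card_univ, Fintype.card_fin]
        exact (congrArg Finset.card hX).trans hcard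
      simpa using Finset.card_image_iff.mp this
    obtain ⟨P, hP, rfl⟩ := exists_height_eq hc
      (fun i j he => hcinj (h.injOn (hcX i) (hcX j) he))
      (fun i => (Finset.mem_erase.mp (h.cast_mem (hcX i))).1)
    refine ⟨P, ?_, Prod.ext hX hU⟩
    rw [Finset.mem_filter, Set.Finite.mem_toFinset, Set.mem_ofPred_eq]
    exact ⟨hP, ht⟩
  · intro P hP
    rw [Finset.mem_filter, Set.Finite.mem_toFinset, Set.mem_ofPred_eq] at hP
    simp only [transversalWeight]
    congr 2
    · rw [heightSet, markedHeights, ← Finset.image_sdiff _ _ (hinj hP.1),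
        Finset.card_image_of_injective _ (hinj hP.1), sdiff_compl,
        heightValleys_height _ (label_lt_of_weight hP.1)]
      simp
    · rw [heightSet, Finset.sum_image fun i _ j _ he => hinj hP.1 he, totalArea, Nat.cast_sum]
      congr 1
      refine Finset.sum_congr rfl fun i _ => ?_
      rw [sub_zero, (height_ediv _ (label_lt_of_weight hP.1 i)).1]

end LabelledDyckPath

/-! ### The coefficients are polynomials -/

/-- Expanding the product over a finite set and reading off one power of the variable. -/
theorem coeff_prod_one_add_X_mul_C {ι K : Type*} [CommSemiring K] (s : Finset ι) (a : ι → K)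
    (b : ℕ) : (∏ i ∈ s, (1 + Polynomial.X * Polynomial.C (a i))).coeff b =
      ∑ S ∈ s.powersetCard b, ∏ i ∈ S, a i := by
  classical
  rw [Finset.prod_one_add, Polynomial.finsetSum_coeff]
  have h : ∀ S : Finset ι, (∏ i ∈ S, (Polynomial.X * Polynomial.C (a i))).coeff b =
      if S.card = b then ∏ i ∈ S, a i else 0 := by
    intro S
    rw [Finset.prod_mul_distrib, Finset.prod_const, ← map_prod, Polynomial.coeff_mul_C,
      Polynomial.coeff_X_pow]
    simp only [eq_comm (a := b), ite_mul, one_mul, zero_mul]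
  simp only [h]
  rw [← Finset.sum_filter, ← Finset.powersetCard_eq_filter]

theorem LaurentPolynomial.prod_T {ι K : Type*} [CommSemiring K] (s : Finset ι) (a : ι → ℤ) :
    ∏ i ∈ s, (LaurentPolynomial.T (a i) : LaurentPolynomial K) =
      LaurentPolynomial.T (∑ i ∈ s, a i) := by
  classical
  induction s using Finset.induction_on with
  | empty => simp
  | insert a s ha ih =>
    rw [Finset.sum_insert ha, Finset.prod_insert ha, LaurentPolynomial.T_add, ih]

namespace LabelledDyckPath

variable {n : ℕ}

theorem T_dinv_mul_coeff {K : Type*} [CommSemiring K] (P : LabelledDyckPath n) (b : ℕ) :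
    (LaurentPolynomial.T (P.dinv : ℤ) : LaurentPolynomial K) *
      (∏ i ∈ P.valleys, (1 + Polynomial.X * Polynomial.C
        (LaurentPolynomial.T (-((P.d i : ℤ) + 1)) : LaurentPolynomial K))).coeff b =
      ∑ S ∈ P.valleys.powersetCard b,
        LaurentPolynomial.T ((P.dinv - ∑ i ∈ S, (P.d i + 1) : ℕ) : ℤ) := by
  rw [coeff_prod_one_add_X_mul_C, Finset.mul_sum]
  refine Finset.sum_congr rfl fun S hS => ?_
  have hle := P.sum_d_add_one_le_dinv (Finset.mem_powersetCard.mp hS).1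
  rw [LaurentPolynomial.prod_T, ← LaurentPolynomial.T_add, Nat.cast_sub hle]
  congr 1
  push_cast
  rw [Finset.sum_neg_distrib, sub_eq_add_neg]

/-- The coefficient of `z ^ b` in `zTerm P`, as a polynomial in `q` over `ℤ[t]`. The subtraction in
the exponent is never truncated. -/
noncomputable def termPoly (P : LabelledDyckPath n) (b : ℕ) : Polynomial (Polynomial ℤ) :=
  ∑ S ∈ P.valleys.powersetCard b,
    Polynomial.X ^ (P.dinv - ∑ i ∈ S, (P.d i + 1)) * Polynomial.C (Polynomial.X ^ P.totalArea)

theorem toLaurent_termPoly (P : LabelledDyckPath n) (b : ℕ) :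
    Polynomial.toLaurent (P.termPoly b) = P.zTerm.coeff b := by
  rw [zTerm, Polynomial.coeff_C_mul, mul_right_comm, P.T_dinv_mul_coeff, termPoly, map_sum,
    Finset.sum_mul]
  refine Finset.sum_congr rfl fun S _ => ?_
  rw [map_mul, Polynomial.toLaurent_X_pow, Polynomial.toLaurent_C]

/-- At `t = 0` only the paths of area zero survive. -/
theorem toLaurent_map_termPoly (P : LabelledDyckPath n) (b : ℕ) :
    Polynomial.toLaurent ((P.termPoly b).map (Polynomial.evalRingHom (0 : ℤ))) =
      if P.totalArea = 0 then P.qzTerm.coeff b else 0 := by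
  rw [qzTerm, Polynomial.coeff_C_mul, P.T_dinv_mul_coeff, termPoly, Polynomial.map_sum, map_sum]
  split_ifs with h
  · refine Finset.sum_congr rfl fun S _ => ?_
    simp [h]
  · refine Finset.sum_eq_zero fun S _ => ?_
    simp [h]

open Classical in
/-- At `q = 0` only tight paths with all their valleys chosen survive. -/
theorem toLaurent_eval_termPoly {P : LabelledDyckPath n} (hP : P.weight = standardWeight n)
    (b : ℕ) : Polynomial.toLaurent ((P.termPoly b).eval 0) =
      if IsTight ((n + 1 : ℕ) : ℤ) (P.height ((n + 1 : ℕ) : ℤ)) then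
        ((Polynomial.X : Polynomial (LaurentPolynomial ℤ)) ^ P.valleys.card *
          Polynomial.C (LaurentPolynomial.T (P.totalArea : ℤ))).coeff b else 0 := by
  have h : ∀ S ∈ P.valleys.powersetCard b, Polynomial.toLaurent
      ((Polynomial.X ^ (P.dinv - ∑ i ∈ S, (P.d i + 1)) *
        Polynomial.C ((Polynomial.X : Polynomial ℤ) ^ P.totalArea)).eval 0) =
      if S = P.valleys then
        if IsTight ((n + 1 : ℕ) : ℤ) (P.height ((n + 1 : ℕ) : ℤ)) then
          (LaurentPolynomial.T (P.totalArea : ℤ) : LaurentPolynomial ℤ) else 0 else 0 := by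
    intro S hS
    have hiff := P.dinv_sub_eq_zero_iff (label_lt_of_weight hP) (Finset.mem_powersetCard.mp hS).1
    rw [Polynomial.eval_mul, Polynomial.eval_pow, Polynomial.eval_X, Polynomial.eval_C,
      zero_pow_eq, ← ite_and, ← if_congr hiff rfl rfl]
    split_ifs
    · rw [one_mul, Polynomial.toLaurent_X_pow]
    · rw [zero_mul, map_zero]
  rw [termPoly, Polynomial.eval_finsetSum, map_sum, Finset.sum_congr rfl h, Finset.sum_ite_eq',
    Polynomial.coeff_mul_C, Polynomial.coeff_X_pow]
  simp only [Finset.mem_powersetCard, subset_rfl, true_and, eq_comm (a := b), ite_mul, one_mul,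
    zero_mul]
  split_ifs <;> rfl

/-! ### Relabelling -/

/-- Relabelling by a map which is strictly increasing on the labels of the path. -/
def relabel (P : LabelledDyckPath n) (g : ℕ+ → ℕ+)
    (hg : ∀ i j, P.label i < P.label j ↔ g (P.label i) < g (P.label j)) : LabelledDyckPath n where
  area := P.area
  label := fun i => g (P.label i)
  area_zero := P.area_zero
  area_step := P.area_step
  label_lt := fun i j hij h => (hg i j).mp (P.label_lt i j hij h)

theorem termPoly_relabel (P : LabelledDyckPath n) (g : ℕ+ → ℕ+)
    (hg : ∀ i j, P.label i < P.label j ↔ g (P.label i) < g (P.label j)) (b : ℕ) :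
    (P.relabel g hg).termPoly b = P.termPoly b := by
  have hd : ∀ i, (P.relabel g hg).d i = P.d i := by
    intro i
    simp only [d, relabel, ← hg]
  have hv : (P.relabel g hg).valleys = P.valleys := by
    simp only [valleys, relabel, ← hg]
  have ha : (P.relabel g hg).totalArea = P.totalArea := rfl
  simp only [termPoly, dinv, hd, hv, ha]

theorem weight_relabel (P : LabelledDyckPath n) (g : ℕ+ → ℕ+)
    (hg : ∀ i j, P.label i < P.label j ↔ g (P.label i) < g (P.label j)) :
    (P.relabel g hg).weight = P.weight.mapDomain g := by
  simp [weight, relabel, Finsupp.mapDomain_finsetSum, Finsupp.mapDomain_single]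

theorem degree_weight (P : LabelledDyckPath n) : P.weight.degree = n := by
  simp [weight]

end LabelledDyckPath

/-! ### The power series over polynomials -/

/-- `Val_{n,k}`, with `b = n - k - 1`, as a power series over `ℤ[t][q]`. -/
noncomputable def valPoly (n b : ℕ) : MvPowerSeries ℕ+ (Polynomial (Polynomial ℤ)) :=
  fun e => ∑ P ∈ (LabelledDyckPath.finite_weight n e).toFinset, P.termPoly b

theorem toLaurentSeries_valPoly (n k : ℕ) :
    toLaurentSeries (valPoly n (n - k - 1)) = valSeries n k := by
  ext e : 1
  rw [toLaurentSeries, MvPowerSeries.coeff_map]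
  change Polynomial.toLaurent (∑ P ∈ _, _) = Polynomial.coeff (∑ P ∈ _, _) _
  rw [map_sum, Polynomial.finsetSum_coeff]
  exact Finset.sum_congr rfl fun P _ => P.toLaurent_termPoly _

theorem toLaurentSeries_injective : Function.Injective toLaurentSeries := by
  intro V W h
  ext e : 1
  have := congrArg (MvPowerSeries.coeff e) h
  rw [toLaurentSeries, MvPowerSeries.coeff_map, MvPowerSeries.coeff_map] at this
  exact Polynomial.toLaurent_injective this

theorem valPoly_eq_zero {n b : ℕ} {e : ℕ+ →₀ ℕ} (he : e.degree ≠ n) : valPoly n b e = 0 := by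
  refine Finset.sum_eq_zero fun P hP => ?_
  rw [Set.Finite.mem_toFinset, Set.mem_ofPred_eq] at hP
  exact absurd (hP ▸ P.degree_weight) he

/-- Coefficients are unchanged by relabellings `g` that are increasing on the support; `g'` is an
inverse of `g` there. -/
theorem valPoly_mapDomain {n : ℕ} (b : ℕ) {e : ℕ+ →₀ ℕ} {g g' : ℕ+ → ℕ+}
    (hg : StrictMonoOn g e.support) (hg' : ∀ x ∈ e.support, g' (g x) = x) :
    valPoly n b (e.mapDomain g) = valPoly n b e := by
  classical
  have hsupp : (e.mapDomain g).support = e.support.image g :=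
    Finsupp.mapDomain_support_of_injOn _ hg.injOn
  have hgg' : ∀ x ∈ (e.mapDomain g).support, g' x ∈ e.support ∧ g (g' x) = x := by
    intro x hx
    rw [hsupp, Finset.mem_image] at hx
    obtain ⟨y, hy, rfl⟩ := hx
    rw [hg' y hy]
    exact ⟨hy, rfl⟩
  have hlab : ∀ {f : ℕ+ →₀ ℕ} {P : LabelledDyckPath n},
      P ∈ (LabelledDyckPath.finite_weight n f).toFinset → P.weight = f ∧
        ∀ i, P.label i ∈ f.support := by
    intro f P hP
    rw [Set.Finite.mem_toFinset, Set.mem_ofPred_eq] at hP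
    exact ⟨hP, fun i => hP ▸ P.label_mem_support i⟩
  have h1 : ∀ P ∈ (LabelledDyckPath.finite_weight n e).toFinset, ∀ i j,
      P.label i < P.label j ↔ g (P.label i) < g (P.label j) := fun P hP i j =>
    (hg.lt_iff_lt ((hlab hP).2 i) ((hlab hP).2 j)).symm
  have h2 : ∀ P ∈ (LabelledDyckPath.finite_weight n (e.mapDomain g)).toFinset, ∀ i j,
      P.label i < P.label j ↔ g' (P.label i) < g' (P.label j) := by
    intro P hP i j
    have hi := hgg' _ ((hlab hP).2 i)
    have hj := hgg' _ ((hlab hP).2 j)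
    rw [← hg.lt_iff_lt hi.1 hj.1, hi.2, hj.2]
  symm
  refine Finset.sum_bij' (fun P hP => P.relabel g (h1 P hP)) (fun P hP => P.relabel g' (h2 P hP))
    ?_ ?_ ?_ ?_ ?_
  · intro P hP
    rw [Set.Finite.mem_toFinset, Set.mem_ofPred_eq, P.weight_relabel, (hlab hP).1]
  · intro P hP
    rw [Set.Finite.mem_toFinset, Set.mem_ofPred_eq, P.weight_relabel, (hlab hP).1,
      ← Finsupp.mapDomain_comp]
    conv_rhs => rw [← Finsupp.mapDomain_id (v := e)]
    exact Finsupp.mapDomain_congr fun x hx => hg' x hx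
  · intro P hP
    exact LabelledDyckPath.ext rfl (funext fun i => hg' _ ((hlab hP).2 i))
  · intro P hP
    exact LabelledDyckPath.ext rfl (funext fun i => (hgg' _ ((hlab hP).2 i)).2)
  · intro P hP
    exact (P.termPoly_relabel g (h1 P hP) b).symm

/-! ### Monomial quasisymmetric functions -/

/-- The exponent vector of `x_1 ^ α_1 ⋯ x_m ^ α_m`. -/
noncomputable def packedWeight {n : ℕ} (α : Composition n) : ℕ+ →₀ ℕ :=
  ∑ j : Fin α.length, Finsupp.single (Nat.succPNat j) (α.blocksFun j)

/-- A composition can be recovered from the exponent vector of any monomial of its monomial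
quasisymmetric function: list the nonzero exponents. -/
theorem blocks_eq_of_eq_sum_single {n : ℕ} {α : Composition n} {e : ℕ+ →₀ ℕ}
    {i : Fin α.length → ℕ+} (hi : StrictMono i)
    (he : e = ∑ j, Finsupp.single (i j) (α.blocksFun j)) :
    α.blocks = (e.support.sort (· ≤ ·)).map e := by
  classical
  have hval : ∀ j, e (i j) = α.blocksFun j := by
    intro j
    rw [he, Finsupp.finsetSum_apply, Finset.sum_eq_single j]
    · simp
    · intro k _ hk
      rw [Finsupp.single_apply, if_neg fun h => hk (hi.injective h)]
    · simp
  have hsupp : e.support = Finset.univ.image i := by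
    ext x
    constructor
    · intro hx
      by_contra hne
      rw [Finsupp.mem_support_iff] at hx
      refine hx ?_
      rw [he, Finsupp.finsetSum_apply]
      refine Finset.sum_eq_zero fun j _ => ?_
      rw [Finsupp.single_apply,
        if_neg fun h => hne (Finset.mem_image.mpr ⟨j, Finset.mem_univ j, h⟩)]
    · intro hx
      obtain ⟨j, -, rfl⟩ := Finset.mem_image.mp hx
      rw [Finsupp.mem_support_iff, hval]
      exact (α.blocks_pos' _ _).ne'
  have hsort : e.support.sort (· ≤ ·) = List.ofFn i := by
    refine List.Perm.eq_of_pairwise' (r := (· ≤ ·)) (Finset.pairwise_sort _ _) ?_ ?_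
    · exact List.pairwise_ofFn.mpr fun a b h => (hi h).le
    · refine (List.perm_ext_iff_of_nodup (Finset.sort_nodup _ _)
        (List.nodup_ofFn.mpr hi.injective)).mpr fun x => ?_
      rw [Finset.mem_sort, hsupp, List.mem_ofFn]
      simp
  rw [hsort, List.map_ofFn, ← α.ofFn_blocksFun]
  congr 1
  funext j
  exact (hval j).symm

theorem exists_composition_of_degree {n : ℕ} {e : ℕ+ →₀ ℕ} (he : e.degree = n) :
    ∃ (α : Composition n) (i : Fin α.length → ℕ+), StrictMono i ∧
      e = ∑ j, Finsupp.single (i j) (α.blocksFun j) := by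
  classical
  let o := e.support.orderEmbOfFin rfl
  have hsum : ∀ {M : Type} [AddCommMonoid M] (F : ℕ+ → M),
      ∑ j, F (o j) = ∑ x ∈ e.support, F x := by
    intro M _ F
    rw [← Finset.sum_image (f := F) (g := o) fun a _ b _ h => o.injective h,
      Finset.image_orderEmbOfFin_univ]
  have hmem : ∀ j, o j ∈ e.support := fun j => Finset.orderEmbOfFin_mem _ rfl j
  let α : Composition n :=
    { blocks := List.ofFn fun j => e (o j)
      blocks_pos := by
        intro a ha
        obtain ⟨j, rfl⟩ := List.mem_ofFn.mp ha
        exact Nat.pos_of_ne_zero (Finsupp.mem_support_iff.mp (hmem j))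
      blocks_sum := by
        rw [List.sum_ofFn, hsum fun x => e x, ← he, Finsupp.degree_apply] }
  have hlen : α.length = e.support.card := by simp [α, Composition.length]
  refine ⟨α, fun j => o (j.cast hlen), fun a b hab => o.strictMono hab, ?_⟩
  have hblocks : ∀ j : Fin α.length, α.blocksFun j = e (o (j.cast hlen)) := by
    intro j
    simp [α, Composition.blocksFun, Fin.cast]
  simp only [hblocks]
  refine (((finCongr hlen).sum_comp fun j => Finsupp.single (o j) (e (o j))).trans ?_).symm
  rw [hsum fun x => Finsupp.single x (e x)]
  exact Finsupp.sum_single e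

theorem degree_sum_single_blocksFun {n : ℕ} (α : Composition n) (i : Fin α.length → ℕ+) :
    (∑ j, Finsupp.single (i j) (α.blocksFun j)).degree = n := by
  simp [α.sum_blocksFun]

theorem coeff_sum_smul_monomialQSym {n : ℕ} (c : Composition n → Polynomial ℤ) {e : ℕ+ →₀ ℕ}
    {α : Composition n} {i : Fin α.length → ℕ+} (hi : StrictMono i)
    (he : e = ∑ j, Finsupp.single (i j) (α.blocksFun j)) :
    MvPowerSeries.coeff e (∑ β : Composition n, c β • monomialQSym β) = c α := by
  classical
  rw [map_sum, Finset.sum_eq_single α]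
  · rw [MvPowerSeries.coeff_smul, MvPowerSeries.coeff_apply, monomialQSym, if_pos ⟨i, hi, he⟩,
      mul_one]
  · intro β _ hβ
    rw [MvPowerSeries.coeff_smul, MvPowerSeries.coeff_apply, monomialQSym, if_neg, mul_zero]
    rintro ⟨i', hi', he'⟩
    exact hβ (Composition.ext
      ((blocks_eq_of_eq_sum_single hi' he').trans (blocks_eq_of_eq_sum_single hi he).symm))
  · simp

/-- A homogeneous power series whose coefficients depend only on the sequence of the nonzero
exponents is a combination of monomial quasisymmetric functions. -/
theorem isMonomialExpansion_of_packed {n : ℕ} {f : MvPowerSeries ℕ+ (Polynomial ℤ)}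
    (h0 : ∀ e : ℕ+ →₀ ℕ, e.degree ≠ n → MvPowerSeries.coeff e f = 0)
    (hf : ∀ (α : Composition n) (i : Fin α.length → ℕ+), StrictMono i →
      MvPowerSeries.coeff (∑ j, Finsupp.single (i j) (α.blocksFun j)) f =
        MvPowerSeries.coeff (packedWeight α) f) :
    IsMonomialExpansion f fun α : Composition n => MvPowerSeries.coeff (packedWeight α) f := by
  rw [IsMonomialExpansion]
  ext e : 1
  by_cases he : e.degree = n
  · obtain ⟨α, i, hi, rfl⟩ := exists_composition_of_degree he
    rw [coeff_sum_smul_monomialQSym _ hi rfl, hf α i hi]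
  · rw [h0 e he, map_sum]
    refine (Finset.sum_eq_zero fun α _ => ?_).symm
    rw [MvPowerSeries.coeff_smul, MvPowerSeries.coeff_apply (monomialQSym α), monomialQSym,
      if_neg, mul_zero]
    rintro ⟨i, -, rfl⟩
    exact he (degree_sum_single_blocksFun α i)

theorem valPoly_sum_single (n b : ℕ) (α : Composition n) {i : Fin α.length → ℕ+}
    (hi : StrictMono i) : valPoly n b (∑ j, Finsupp.single (i j) (α.blocksFun j)) =
      valPoly n b (packedWeight α) := by
  classical
  let p : Fin α.length → ℕ+ := fun j => Nat.succPNat j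
  have hp : StrictMono p := fun a b hab => Nat.succPNat_lt_succPNat.mpr hab
  have hg : ∀ j, Function.extend i p id (i j) = p j := fun j => hi.injective.extend_apply _ _ j
  have hg' : ∀ j, Function.extend p i id (p j) = i j := fun j => hp.injective.extend_apply _ _ j
  have hsupp : ∀ x ∈ (∑ j, Finsupp.single (i j) (α.blocksFun j)).support, ∃ j, i j = x := by
    intro x hx
    obtain ⟨j, -, hj⟩ := Finset.mem_biUnion.mp (Finsupp.support_finsetSum hx)
    exact ⟨j, (Finset.mem_singleton.mp (Finsupp.support_single_subset hj)).symm⟩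
  have := valPoly_mapDomain (n := n) b (e := ∑ j, Finsupp.single (i j) (α.blocksFun j))
    (g := Function.extend i p id) (g' := Function.extend p i id) ?_ ?_
  · rw [← this, Finsupp.mapDomain_finsetSum, packedWeight]
    simp only [Finsupp.mapDomain_single, hg, p]
  · intro x hx y hy hxy
    obtain ⟨j, rfl⟩ := hsupp x hx
    obtain ⟨k, rfl⟩ := hsupp y hy
    rw [hg, hg]
    exact hp (hi.lt_iff_lt.mp hxy)
  · intro x hx
    obtain ⟨j, rfl⟩ := hsupp x hx
    rw [hg, hg']

theorem exists_isMonomialExpansion_map_valPoly (n b : ℕ)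
    (φ : Polynomial (Polynomial ℤ) →+* Polynomial ℤ) :
    ∃ a : Composition n → Polynomial ℤ,
      IsMonomialExpansion (MvPowerSeries.map φ (valPoly n b)) a := by
  refine ⟨_, isMonomialExpansion_of_packed (fun e he => ?_) fun α i hi => ?_⟩
  · rw [MvPowerSeries.coeff_map, MvPowerSeries.coeff_apply, valPoly_eq_zero he, map_zero]
  · rw [MvPowerSeries.coeff_map, MvPowerSeries.coeff_map, MvPowerSeries.coeff_apply,
      MvPowerSeries.coeff_apply, valPoly_sum_single n b α hi]

theorem packedWeight_ones (n : ℕ) : packedWeight (Composition.ones n) = standardWeight n := by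
  rw [packedWeight, standardWeight]
  simp only [Composition.ones_blocksFun]
  exact (finCongr (Composition.ones_length n)).sum_comp
    fun j : Fin n => Finsupp.single (Nat.succPNat j) 1

/-! ### The two specializations -/

/-- Both specializations of the coefficient of `x_1 ⋯ x_n` are coefficients of `rankPoly n 0`. -/
theorem coeff_standardWeight_specQZero_eq (n b : ℕ) :
    MvPowerSeries.coeff (standardWeight n) (specQZero (valPoly n b)) =
      MvPowerSeries.coeff (standardWeight n) (specZeroQ (valPoly n b)) := by
  classical
  have hw : ∀ {P : LabelledDyckPath n},
      P ∈ (LabelledDyckPath.finite_weight n (standardWeight n)).toFinset →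
        P.weight = standardWeight n := fun hP => by
    rwa [Set.Finite.mem_toFinset, Set.mem_ofPred_eq] at hP
  apply Polynomial.toLaurent_injective
  rw [specQZero, specZeroQ, MvPowerSeries.coeff_map, MvPowerSeries.coeff_map,
    MvPowerSeries.coeff_apply, valPoly, map_sum, map_sum, map_sum, map_sum]
  trans (rankPoly n 0).coeff b
  · rw [← LabelledDyckPath.sum_qzTerm_area_zero, Polynomial.finsetSum_coeff, Finset.sum_filter]
    exact Finset.sum_congr rfl fun P _ => P.toLaurent_map_termPoly b
  · rw [← LabelledDyckPath.sum_tight, Polynomial.finsetSum_coeff, Finset.sum_filter]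
    exact (Finset.sum_congr rfl fun P hP =>
      LabelledDyckPath.toLaurent_eval_termPoly (hw hP) b).symm

theorem mainTheorem7 (n k : ℕ) (hkn : k < n) :
    (∃ V, toLaurentSeries V = valSeries n k) ∧
    ∀ V, toLaurentSeries V = valSeries n k →
      (∃ a : Composition n → Polynomial ℤ, IsMonomialExpansion (specQZero V) a) ∧
      (∃ b : Composition n → Polynomial ℤ, IsMonomialExpansion (specZeroQ V) b) ∧
      ∀ a b : Composition n → Polynomial ℤ,
        IsMonomialExpansion (specQZero V) a → IsMonomialExpansion (specZeroQ V) b →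
          a (Composition.ones n) = b (Composition.ones n) := by
  refine ⟨⟨_, toLaurentSeries_valPoly n k⟩, fun V hV => ?_⟩
  obtain rfl : V = valPoly n (n - k - 1) :=
    toLaurentSeries_injective (hV.trans (toLaurentSeries_valPoly n k).symm)
  refine ⟨exists_isMonomialExpansion_map_valPoly n _ _,
    exists_isMonomialExpansion_map_valPoly n _ _, fun a b ha hb => ?_⟩
  have hmono : StrictMono fun j : Fin (Composition.ones n).length => Nat.succPNat j :=
    fun _ _ hab => Nat.succPNat_lt_succPNat.mpr hab
  rw [← coeff_sum_smul_monomialQSym a hmono rfl, ← coeff_sum_smul_monomialQSym b hmono rfl,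
    ← ha, ← hb]
  have he := packedWeight_ones n
  rw [packedWeight] at he
  rw [he]
  exact coeff_standardWeight_specQZero_eq n _
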